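/- **Setting.** Let $(W,S)$ be a Coxeter system with set of reflections $T=\{wsw^{-1}: w\in W, s\in S\}$, and let $V$ be a finite-dimensional vector space over a field $\Bbbk$ of characteristic $\neq 2$ on which $W$ acts linearly and faithfully so that every $s\in S$ acts by a reflection, i.e. $sv=v-\alpha_s^\vee(v)\alpha_s$ with $\alpha_s\in V$, $\alpha_s^\vee\in V^*$, $\alpha_s^\vee(\alpha_s)=2$. Then every $t\in T$ acts by a reflection; fix for each $t\in T$ a root $\alpha_t\in V$, that is, a vector such that $tv=v-\alpha_t^\vee(v)\alpha_t$ for all $v\in V$ and some $\alpha_t^\vee\in V^*$ with $\alpha_t^\vee(\alpha_t)=2$. Assume the GKM-condition: if $\alpha_t$ and $\alpha_{t'}$ are proportional, then $t=t'$. Grade $\mathrm{Sym}(V)$ so that $V$ has degree $2$, let $Q=\bigoplus_i Q_i$ be its localization at all nonzero homogeneous elements, let $\boldsymbol\sigma\subset\mathrm{Sym}(V)$ be a $W$-invariant multiplicative set of nonzero homogeneous elements none of which is divisible by any $\alpha_t$, and let $R=\boldsymbol\sigma^{-1}\mathrm{Sym}(V)\subset Q$ with the induced grading. Let $\underline t=(t_1,\dots,t_n)$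 be a sequence of elements of $T$ ($n\ge 0$) and $w\in W$. A subexpression is $\underline\epsilon\in\{0,1\}^n$; put $\underline\epsilon^{<i}=t_1^{\epsilon_1}\cdots t_{i-1}^{\epsilon_{i-1}}$, let $\mathrm{Sub}(\underline t,w)$ be the set of $\underline\epsilon$ with $t_1^{\epsilon_1}\cdots t_n^{\epsilon_n}=w$, and for $p\in T$ let $\mathcal M_p(\underline\epsilon)=\{i : \underline\epsilon^{<i}t_i(\underline\epsilon^{<i})^{-1}=p\}$. For $Y\subset\{1,\dots,n\}$ let $f_Y\underline\epsilon$ be $\underline\epsilon$ with the entries at the positions in $Y$ flipped. For $Y\subset X\subset\{1,\dots,n\}$ let $|Y|_X$ be the number of elements of $Y$ at odd positions of $X$, counted decreasingly (so the maximum of $X$ is at position $1$). Put $$\Sigma_X^{\underline\epsilon}(g)=\sum_{Y\subset X}(-1)^{|Y|_X}g(f_Y\underline\epsilon),\qquad \Sigma_X^{\underline\epsilon,\mathrm{ev}}(g)=\sum_{Y\subset X,\ |Y|\text{ even}}(-1)^{|Y|_X}g(f_Y\underline\epsilon).$$ Define the left $R$-modules: * $\mathcal X(\underline t)$: all $g:\{0,1\}^n\to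 R$ with $\Sigma_X^{\underline\epsilon}(g)\in\alpha_p^{|X|}R$ for all $\underline\epsilon\in\{0,1\}^n$, $p\in T$, $X\subset\mathcal M_p(\underline\epsilon)$; * $\mathcal Y_w(\underline t)$: the restrictions to $\mathrm{Sub}(\underline t,w)$ of all $g\in\mathcal X(\underline t)$; * $\mathcal X^w(\underline t)$: all $g:\mathrm{Sub}(\underline t,w)\to R$ with $\Sigma_X^{\underline\epsilon,\mathrm{ev}}(g)\in\alpha_p^{|X|}R$ for all $\underline\epsilon\in\mathrm{Sub}(\underline t,w)$, $p\in T$, $X\subset\mathcal M_p(\underline\epsilon)$; * $\mathcal X_w(\underline t)$: all $g:\mathrm{Sub}(\underline t,w)\to R$ with $\Sigma_X^{\underline\epsilon,\mathrm{ev}}(g)\in\alpha_p^{|X|-1}R$ for all $\underline\epsilon\in\mathrm{Sub}(\underline t,w)$, $p\in T$, $\emptyset\ne X\subset\mathcal M_p(\underline\epsilon)$. These are submodules of the $R$-module $Q^{\oplus\underline t}(w)$ of all functions $\mathrm{Sub}(\underline t,w)\to Q$ (respectively, for $\mathcal X(\underline t)$, of all functions $\{0,1\}^n\to Q$), graded by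 the degrees of values. Let $o(\underline\epsilon)=\prod_{i=1}^n\underline\epsilon^{<i}\alpha_{t_i}$ and $$\langle g|h\rangle=\sum_{\underline\epsilon\in\mathrm{Sub}(\underline t,w)}\frac{g(\underline\epsilon)h(\underline\epsilon)}{o(\underline\epsilon)}\in Q,\qquad g,h\in Q^{\oplus\underline t}(w).$$ For an $R$-submodule $M\subset Q^{\oplus\underline t}(w)$ let $DM=\{g\in Q^{\oplus\underline t}(w) : \langle g|h\rangle\in R\text{ for all }h\in M\}$. For a graded $R$-module $M$, let $\mathrm{Hom}^\bullet_R(M,R)=\bigoplus_{m\in\mathbb Z}\mathrm{Hom}^m_R(M,R)\subset \mathrm{Hom}_R(M,R)$, where $\mathrm{Hom}^m_R(M,R)$ consists of the $R$-linear maps $\phi$ with $\phi(M_i)\subset R_{m+i}$ for all $i$; the shift is $N(m)_i=N_{m+i}$. **Theorem.** 1. $D\mathcal Y_w(\underline t)=D\mathcal X_w(\underline t)=\mathcal X^w(\underline t)$. 2. Let $M$ be a graded $R$-submodule of $Q^{\oplus\underline t}(w)$ with $\mathcal Y_w(\underline t)\subset M\subset\mathcal X_w(\underline t)$. Then $h\mapsto\langle\,\cdot\,|h\rangle$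 is an isomorphism of graded $R$-modules $$\mathcal X^w(\underline t)\ \xrightarrow{\ \sim\ }\ \mathrm{Hom}^\bullet_R(M,R)(-2n).$$ 3. $g\mapsto\langle g|\,\cdot\,\rangle$ is an isomorphism of graded $R$-modules $$\mathcal X_w(\underline t)\ \xrightarrow{\ \sim\ }\ \mathrm{Hom}^\bullet_R(\mathcal X^w(\underline t),R)(-2n).$$ -/

import Mathlib

noncomputable section

namespace BottSamelson

open SymmetricAlgebra

/-! ### The graded ring `Sym V`, its graded localizations `Q` and `R` -/

section Rings

variable (k : Type*) [Field k] (V : Type*) [AddCommGroup V] [Module k V]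

/-- The homogeneous part of degree `i` of `Sym V`, where elements of `V` have degree `2`:
it is the span of all products of `d` vectors if `i = 2 * d`, and zero if there is no such `d`. -/
def symGr (i : ℤ) : Submodule k (SymmetricAlgebra k V) :=
  ⨆ (d : ℕ) (_ : 2 * (d : ℤ) = i), LinearMap.range (ι k V) ^ d

variable {k V} in
theorem mul_mem_symGr {i j : ℤ} {a b : SymmetricAlgebra k V}
    (ha : a ∈ symGr k V i) (hb : b ∈ symGr k V j) : a * b ∈ symGr k V (i + j) := by
  have h : symGr k V i * symGr k V j ≤ symGr k V (i + j) := by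
    unfold symGr
    simp only [Submodule.iSup_mul, Submodule.mul_iSup]
    refine iSup_le fun d => iSup_le fun hd => iSup_le fun e => iSup_le fun he => ?_
    rw [← pow_add]
    exact le_iSup₂_of_le (e + d) (by push_cast; omega) le_rfl
  exact h (Submodule.mul_mem_mul ha hb)

variable {k V} in
theorem pow_range_le_symGr (d : ℕ) :
    LinearMap.range (ι k V) ^ d ≤ symGr k V (2 * (d : ℤ)) :=
  le_iSup₂_of_le (f := fun (e : ℕ) (_ : 2 * (e : ℤ) = 2 * (d : ℤ)) =>
    LinearMap.range (ι k V) ^ e) d rfl le_rfl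

variable {k V} in
theorem one_mem_symGr : (1 : SymmetricAlgebra k V) ∈ symGr k V 0 := by
  have h := pow_range_le_symGr (k := k) (V := V) 0
  simp only [pow_zero, Nat.cast_zero, mul_zero] at h
  exact h (Submodule.one_le.mp le_rfl)

variable {k V} in
theorem ι_mem_symGr (v : V) : ι k V v ∈ symGr k V 2 := by
  have h := pow_range_le_symGr (k := k) (V := V) 1
  simp only [pow_one, Nat.cast_one, mul_one] at h
  exact h ⟨v, rfl⟩

variable {k V} in
theorem iSup_symGr : ⨆ i : ℤ, symGr k V i = ⊤ := by
  refine Submodule.eq_top_iff'.2 fun a => ?_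
  induction a using SymmetricAlgebra.induction with
  | algebraMap r =>
    rw [Algebra.algebraMap_eq_smul_one]
    exact Submodule.smul_mem _ _ (Submodule.mem_iSup_of_mem 0 one_mem_symGr)
  | ι v => exact Submodule.mem_iSup_of_mem 2 (ι_mem_symGr v)
  | mul a b ha hb =>
    have h : (⨆ i : ℤ, symGr k V i) * (⨆ i : ℤ, symGr k V i) ≤ ⨆ i : ℤ, symGr k V i := by
      simp only [Submodule.iSup_mul, Submodule.mul_iSup]
      refine iSup_le fun i => iSup_le fun j => Submodule.mul_le.2 fun x hx y hy => ?_
      exact Submodule.mem_iSup_of_mem _ (mul_mem_symGr hx hy)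
    exact h (Submodule.mul_mem_mul ha hb)
  | add a b ha hb => exact Submodule.add_mem _ ha hb

/-- The multiplicative set of all nonzero homogeneous elements of `Sym V`. -/
def homNonzero : Submonoid (SymmetricAlgebra k V) where
  carrier := {s | s ≠ 0 ∧ ∃ i, s ∈ symGr k V i}
  one_mem' := ⟨one_ne_zero, 0, one_mem_symGr⟩
  mul_mem' := by
    rintro a b ⟨ha, i, hi⟩ ⟨hb, j, hj⟩
    exact ⟨mul_ne_zero ha hb, i + j, mul_mem_symGr hi hj⟩

/-- The ring `Q`: the localization of `Sym V` at all nonzero homogeneous elements. -/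
def QRing : Type _ := Localization (homNonzero k V)

instance : CommRing (QRing k V) := inferInstanceAs (CommRing (Localization (homNonzero k V)))

instance : Algebra (SymmetricAlgebra k V) (QRing k V) :=
  inferInstanceAs (Algebra (SymmetricAlgebra k V) (Localization (homNonzero k V)))

instance : IsLocalization (homNonzero k V) (QRing k V) :=
  inferInstanceAs (IsLocalization (homNonzero k V) (Localization (homNonzero k V)))

/-- The homogeneous part `Q_i`: all fractions `p / s` with `p`, `s` homogeneous, `s ≠ 0` and
`deg p - deg s = i`. -/
def qGr (i : ℤ) : AddSubgroup (QRing k V) where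
  carrier := {x | ∃ (a b : ℤ) (p s : SymmetricAlgebra k V), p ∈ symGr k V a ∧ s ∈ symGr k V b ∧
    s ≠ 0 ∧ a - b = i ∧ algebraMap _ (QRing k V) s * x = algebraMap _ (QRing k V) p}
  zero_mem' := ⟨i, 0, 0, 1, Submodule.zero_mem _, one_mem_symGr, one_ne_zero, by simp, by simp⟩
  add_mem' := by
    rintro x y ⟨a, b, p, s, hp, hs, hs0, hab, hx⟩ ⟨a', b', p', s', hp', hs', hs0', hab', hy⟩
    refine ⟨a + b', b + b', p * s' + s * p', s * s', Submodule.add_mem _ (mul_mem_symGr hp hs') ?_,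
      mul_mem_symGr hs hs', mul_ne_zero hs0 hs0', by omega, ?_⟩
    · have : a + b' = b + a' := by omega
      rw [this]
      exact mul_mem_symGr hs hp'
    · simp only [map_mul, map_add, ← hx, ← hy]
      ring
  neg_mem' := by
    rintro x ⟨a, b, p, s, hp, hs, hs0, hab, hx⟩
    exact ⟨a, b, -p, s, Submodule.neg_mem _ hp, hs, hs0, hab, by simp only [map_neg, ← hx, mul_neg]⟩

variable {k V}

/-- The ring `R = σ⁻¹ Sym V` as a subring of `Q`. -/
def rRing (σ : Submonoid (SymmetricAlgebra k V)) : Subring (QRing k V) where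
  carrier := {x | ∃ s ∈ σ, ∃ p : SymmetricAlgebra k V,
    algebraMap _ (QRing k V) s * x = algebraMap _ (QRing k V) p}
  one_mem' := ⟨1, σ.one_mem, 1, by simp⟩
  zero_mem' := ⟨1, σ.one_mem, 0, by simp⟩
  mul_mem' := by
    rintro x y ⟨s, hs, p, hx⟩ ⟨s', hs', p', hy⟩
    refine ⟨s * s', σ.mul_mem hs hs', p * p', ?_⟩
    simp only [map_mul, ← hx, ← hy]
    ring
  add_mem' := by
    rintro x y ⟨s, hs, p, hx⟩ ⟨s', hs', p', hy⟩
    refine ⟨s * s', σ.mul_mem hs hs', p * s' + s * p', ?_⟩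
    simp only [map_mul, map_add, ← hx, ← hy]
    ring
  neg_mem' := by
    rintro x ⟨s, hs, p, hx⟩
    exact ⟨s, hs, -p, by simp only [map_neg, ← hx, mul_neg]⟩

/-- A vector of `V` as an element of `Q`. -/
def vecQ (v : V) : QRing k V := algebraMap (SymmetricAlgebra k V) (QRing k V) (ι k V v)

theorem isUnit_vecQ {v : V} (hv : v ≠ 0) : IsUnit (vecQ (k := k) v) := by
  refine IsLocalization.map_units (QRing k V) (⟨ι k V v, ?_, 2, ι_mem_symGr v⟩ : homNonzero k V)
  intro h0
  let b := Module.Free.chooseBasis k V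
  obtain ⟨i, hi⟩ : ∃ i, b.repr v i ≠ 0 := by
    by_contra! hc
    exact hv (b.repr.map_eq_zero_iff.mp (Finsupp.ext hc))
  have h1 : SymmetricAlgebra.lift (b.coord i) (ι k V v) = b.coord i v :=
    SymmetricAlgebra.lift_ι_apply _ _
  rw [h0, map_zero] at h1
  exact hi h1.symm

end Rings

/-! ### Reflections and roots -/

section Reflections

variable {k : Type*} [Field k] {V : Type*} [AddCommGroup V] [Module k V] {W : Type*} [Group W]

/-- `a` is a root of `t`: for some coroot `f` with `f a = 2`, `t` acts as `v ↦ v - f(v) a`. -/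
def IsRoot (ρ : Representation k W V) (t : W) (a : V) : Prop :=
  ∃ f : Module.Dual k V, f a = 2 ∧ ∀ v, ρ t v = v - f v • a

/-- The action of `w` on `Sym V` induced from its action on `V`. -/
def symAct (ρ : Representation k W V) (w : W) : SymmetricAlgebra k V →ₐ[k] SymmetricAlgebra k V :=
  SymmetricAlgebra.lift (ι k V ∘ₗ ρ w)

variable {B : Type*} {C : CoxeterMatrix B}

/-- The set `T` of reflections of a Coxeter system. -/
abbrev Refl (cs : CoxeterSystem C W) : Type _ := {t : W // cs.IsReflection t}

/-- If the simple reflections act on `V` by reflections, then so do all reflections. -/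
theorem exists_root (cs : CoxeterSystem C W) (ρ : Representation k W V)
    (h : ∀ b : B, ∃ a : V, IsRoot ρ (cs.simple b) a) (t : Refl cs) : ∃ a : V, IsRoot ρ t.1 a := by
  obtain ⟨t, w, b, rfl⟩ := t
  obtain ⟨a, f, hfa, hf⟩ := h b
  refine ⟨ρ w a, f ∘ₗ ρ w⁻¹, ?_, fun v => ?_⟩
  · simp [← Module.End.mul_apply, ← map_mul, hfa]
  · have : ρ w (ρ w⁻¹ v) = v := by simp [← Module.End.mul_apply, ← map_mul]
    simp [hf, this]

/-- The multiplicative set `σ` is admissible: it consists of nonzero homogeneous elements, is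
`W`-invariant, and contains no element divisible by a root. -/
structure Admissible {cs : CoxeterSystem C W} (ρ : Representation k W V) (α : Refl cs → V)
    (σ : Submonoid (SymmetricAlgebra k V)) : Prop where
  graded : ∀ s ∈ σ, ∃ i, s ∈ symGr k V i
  zero_notMem : (0 : SymmetricAlgebra k V) ∉ σ
  invariant : ∀ (w : W), ∀ s ∈ σ, symAct ρ w s ∈ σ
  not_dvd : ∀ (p : Refl cs), ∀ s ∈ σ, ¬ ι k V (α p) ∣ s

end Reflections

/-! ### Subexpressions -/

section Subexpressions

variable {W : Type*} [Group W] {B : Type*} {C : CoxeterMatrix B} {cs : CoxeterSystem C W}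
  {n : ℕ} (t : Fin n → Refl cs)

/-- The list `t_1^{ε_1}, …, t_n^{ε_n}`. Subexpressions are maps `ε : Fin n → Bool`,
where `true` stands for `1` and `false` stands for `0`. -/
def powers (ε : Fin n → Bool) : List W := List.ofFn fun i => if ε i then (t i).1 else 1

/-- The target (total product) of a subexpression. -/
def target (ε : Fin n → Bool) : W := (powers t ε).prod

/-- The partial product `ε^{<i}` of all factors strictly before position `i`. -/
def before (ε : Fin n → Bool) (i : Fin n) : W := ((powers t ε).take i.1).prod

/-- The set `Sub(t, w)` of subexpressions with target `w`. -/
abbrev SubTo (w : W) : Type := {ε : Fin n → Bool // target t ε = w}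

/-- The set `M_p(ε)` of all positions `i` with `ε^{<i} t_i (ε^{<i})⁻¹ = p`. -/
def positions (ε : Fin n → Bool) (p : Refl cs) : Set (Fin n) :=
  {i | before t ε i * (t i).1 * (before t ε i)⁻¹ = p.1}

/-- Flipping the entries of `ε` at the positions of `Y`. -/
def flip (Y : Finset (Fin n)) (ε : Fin n → Bool) : Fin n → Bool :=
  fun i => if i ∈ Y then !(ε i) else ε i

/-- The cardinality of `Y ⊆ X` relative to `X`: the number of elements of `Y` that are at odd
positions of `X` counted decreasingly (so that the maximum of `X` has position `1`). -/
def relCard (X Y : Finset (Fin n)) : ℕ :=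
  (Y.filter fun y => Odd (X.filter fun x => y ≤ x).card).card

/-- Extension by zero of a function from `Sub(t, w)` to all subexpressions of `t`. -/
def extendZero {A : Type*} [Zero A] {w : W} (g : SubTo t w → A) (ε : Fin n → Bool) : A :=
  open Classical in if h : target t ε = w then g ⟨ε, h⟩ else 0

end Subexpressions

/-! ### The modules `X(t)`, `X^w(t)`, `X_w(t)`, `Y_w(t)` and the inner product -/

section Modules

variable {k : Type*} [Field k] {V : Type*} [AddCommGroup V] [Module k V]

/-- The alternating sum `∑_{Y ⊆ X} (-1)^{|Y|_X} g(f_Y ε)` over all subsets. -/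
def sigmaAll {n : ℕ} (X : Finset (Fin n)) (ε : Fin n → Bool) (g : (Fin n → Bool) → QRing k V) :
    QRing k V :=
  ∑ Y ∈ X.powerset, (-1) ^ relCard X Y * g (flip Y ε)

/-- The alternating sum `∑_{Y ⊆ X, |Y| even} (-1)^{|Y|_X} g(f_Y ε)` over even subsets. -/
def sigmaEven {n : ℕ} (X : Finset (Fin n)) (ε : Fin n → Bool) (g : (Fin n → Bool) → QRing k V) :
    QRing k V :=
  ∑ Y ∈ X.powerset with Even Y.card, (-1) ^ relCard X Y * g (flip Y ε)

variable {W : Type*} [Group W] {B : Type*} {C : CoxeterMatrix B} {cs : CoxeterSystem C W}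
  {n : ℕ}

/-- The ideal `α_p^m R`, as an `R`-submodule of `Q`. -/
def rootPow (α : Refl cs → V) (σ : Submonoid (SymmetricAlgebra k V)) (p : Refl cs) (m : ℕ) :
    Submodule (rRing σ) (QRing k V) :=
  Submodule.span (rRing σ) {vecQ (α p) ^ m}

/-- The module `X(t)` of all `R`-valued functions `g` on the subexpressions of `t` such that the
full alternating sums over `X ⊆ M_p(ε)` are divisible by `α_p^{|X|}` in `R`. -/
def XAll (α : Refl cs → V) (σ : Submonoid (SymmetricAlgebra k V)) (t : Fin n → Refl cs) :
    Submodule (rRing σ) ((Fin n → Bool) → QRing k V) where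
  carrier := {g | (∀ ε, g ε ∈ rRing σ) ∧ ∀ (ε : Fin n → Bool) (p : Refl cs) (X : Finset (Fin n)),
    (X : Set (Fin n)) ⊆ positions t ε p → sigmaAll X ε g ∈ rootPow α σ p X.card}
  zero_mem' := ⟨fun _ => (rRing σ).zero_mem, fun ε p X _ => by
    simp [sigmaAll]⟩
  add_mem' := by
    rintro g h ⟨hg, hg'⟩ ⟨hh, hh'⟩
    refine ⟨fun ε => (rRing σ).add_mem (hg ε) (hh ε), fun ε p X hX => ?_⟩
    have : sigmaAll X ε (g + h) = sigmaAll X ε g + sigmaAll X ε h := by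
      simp [sigmaAll, mul_add, Finset.sum_add_distrib]
    rw [this]
    exact Submodule.add_mem _ (hg' ε p X hX) (hh' ε p X hX)
  smul_mem' := by
    rintro r g ⟨hg, hg'⟩
    refine ⟨fun ε => (rRing σ).mul_mem r.2 (hg ε), fun ε p X hX => ?_⟩
    have : sigmaAll X ε (r • g) = r • sigmaAll X ε g := by
      simp [sigmaAll, Finset.smul_sum]
    rw [this]
    exact Submodule.smul_mem _ _ (hg' ε p X hX)

theorem sigmaEven_zero (t : Fin n → Refl cs) (w : W) (X : Finset (Fin n)) (ε : Fin n → Bool) :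
    sigmaEven X ε (extendZero t (0 : SubTo t w → QRing k V)) = 0 := by
  simp [sigmaEven, extendZero]

theorem sigmaEven_add {t : Fin n → Refl cs} {w : W} (X : Finset (Fin n)) (ε : Fin n → Bool)
    (g h : SubTo t w → QRing k V) : sigmaEven X ε (extendZero t (g + h)) =
      sigmaEven X ε (extendZero t g) + sigmaEven X ε (extendZero t h) := by
  rw [sigmaEven, sigmaEven, sigmaEven, ← Finset.sum_add_distrib]
  refine Finset.sum_congr rfl fun Y _ => ?_
  rw [← mul_add]
  congr 1
  unfold extendZero
  split_ifs <;> simp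

theorem sigmaEven_smul {σ : Submonoid (SymmetricAlgebra k V)} {t : Fin n → Refl cs} {w : W}
    (X : Finset (Fin n)) (ε : Fin n → Bool) (r : rRing σ) (g : SubTo t w → QRing k V) :
    sigmaEven X ε (extendZero t (r • g)) = r • sigmaEven X ε (extendZero t g) := by
  rw [sigmaEven, sigmaEven, Finset.smul_sum]
  refine Finset.sum_congr rfl fun Y _ => ?_
  rw [← mul_smul_comm]
  congr 1
  unfold extendZero
  split_ifs <;> simp

/-- The module `X^w(t)`: all `R`-valued `g` on `Sub(t, w)` such that the even alternating sums over
`X ⊆ M_p(ε)` are divisible by `α_p^{|X|}` in `R`. -/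
def XUpper (α : Refl cs → V) (σ : Submonoid (SymmetricAlgebra k V)) (t : Fin n → Refl cs) (w : W) :
    Submodule (rRing σ) (SubTo t w → QRing k V) where
  carrier := {g | (∀ ε, g ε ∈ rRing σ) ∧ ∀ (ε : SubTo t w) (p : Refl cs) (X : Finset (Fin n)),
    (X : Set (Fin n)) ⊆ positions t ε.1 p →
      sigmaEven X ε.1 (extendZero t g) ∈ rootPow α σ p X.card}
  zero_mem' := ⟨fun _ => (rRing σ).zero_mem, fun ε p X _ => by
    rw [sigmaEven_zero]; exact Submodule.zero_mem _⟩
  add_mem' := by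
    rintro g h ⟨hg, hg'⟩ ⟨hh, hh'⟩
    refine ⟨fun ε => (rRing σ).add_mem (hg ε) (hh ε), fun ε p X hX => ?_⟩
    rw [sigmaEven_add]
    exact Submodule.add_mem _ (hg' ε p X hX) (hh' ε p X hX)
  smul_mem' := by
    rintro r g ⟨hg, hg'⟩
    refine ⟨fun ε => (rRing σ).mul_mem r.2 (hg ε), fun ε p X hX => ?_⟩
    rw [sigmaEven_smul]
    exact Submodule.smul_mem _ _ (hg' ε p X hX)

/-- The module `X_w(t)`: all `R`-valued `g` on `Sub(t, w)` such that the even alternating sums over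
nonempty `X ⊆ M_p(ε)` are divisible by `α_p^{|X| - 1}` in `R`. -/
def XLower (α : Refl cs → V) (σ : Submonoid (SymmetricAlgebra k V)) (t : Fin n → Refl cs) (w : W) :
    Submodule (rRing σ) (SubTo t w → QRing k V) where
  carrier := {g | (∀ ε, g ε ∈ rRing σ) ∧ ∀ (ε : SubTo t w) (p : Refl cs) (X : Finset (Fin n)),
    X.Nonempty → (X : Set (Fin n)) ⊆ positions t ε.1 p →
      sigmaEven X ε.1 (extendZero t g) ∈ rootPow α σ p (X.card - 1)}
  zero_mem' := ⟨fun _ => (rRing σ).zero_mem, fun ε p X _ _ => by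
    rw [sigmaEven_zero]; exact Submodule.zero_mem _⟩
  add_mem' := by
    rintro g h ⟨hg, hg'⟩ ⟨hh, hh'⟩
    refine ⟨fun ε => (rRing σ).add_mem (hg ε) (hh ε), fun ε p X hX0 hX => ?_⟩
    rw [sigmaEven_add]
    exact Submodule.add_mem _ (hg' ε p X hX0 hX) (hh' ε p X hX0 hX)
  smul_mem' := by
    rintro r g ⟨hg, hg'⟩
    refine ⟨fun ε => (rRing σ).mul_mem r.2 (hg ε), fun ε p X hX0 hX => ?_⟩
    rw [sigmaEven_smul]
    exact Submodule.smul_mem _ _ (hg' ε p X hX0 hX)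

/-- The module `Y_w(t)` of the restrictions to `Sub(t, w)` of all functions of `X(t)`. -/
def YLower (α : Refl cs → V) (σ : Submonoid (SymmetricAlgebra k V)) (t : Fin n → Refl cs) (w : W) :
    Submodule (rRing σ) (SubTo t w → QRing k V) :=
  (XAll α σ t).map (LinearMap.funLeft (rRing σ) (QRing k V) Subtype.val)

/-- The element `o(ε) = ∏ i, ε^{<i} α_{t_i}`. -/
def oFun (ρ : Representation k W V) (α : Refl cs → V) (t : Fin n → Refl cs) (ε : Fin n → Bool) :
    QRing k V :=
  ∏ i, vecQ (ρ (before t ε i) (α (t i)))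

/-- `o(ε)` is invertible in `Q` as soon as the roots are nonzero. -/
theorem isUnit_oFun (ρ : Representation k W V) (α : Refl cs → V) (hα : ∀ p, α p ≠ 0)
    (t : Fin n → Refl cs) (ε : Fin n → Bool) : IsUnit (oFun ρ α t ε) := by
  refine (IsUnit.prod_iff).2 fun i _ => isUnit_vecQ fun h => hα (t i) ?_
  rw [← Representation.inv_self_apply ρ (before t ε i) (α (t i)), h, map_zero]

/-- The inner product `⟨g|h⟩ = ∑_{ε ∈ Sub(t, w)} g(ε) h(ε) / o(ε)` with values in `Q`. -/
def pairing (ρ : Representation k W V) (α : Refl cs → V) (t : Fin n → Refl cs) (w : W)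
    (g h : SubTo t w → QRing k V) : QRing k V :=
  open Classical in ∑ ε : SubTo t w, g ε * h ε * Ring.inverse (oFun ρ α t ε.1)

/-- The module `D N` of all functions whose inner products with all elements of `N` are in `R`. -/
def dualMod (ρ : Representation k W V) (α : Refl cs → V) (σ : Submonoid (SymmetricAlgebra k V))
    (t : Fin n → Refl cs) (w : W) (N : Submodule (rRing σ) (SubTo t w → QRing k V)) :
    Submodule (rRing σ) (SubTo t w → QRing k V) where
  carrier := {g | ∀ h ∈ N, pairing ρ α t w g h ∈ rRing σ}
  zero_mem' := fun h _ => by simp [pairing, (rRing σ).zero_mem]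
  add_mem' := by
    intro g g' hg hg' h hh
    have : pairing ρ α t w (g + g') h = pairing ρ α t w g h + pairing ρ α t w g' h := by
      simp [pairing, add_mul, Finset.sum_add_distrib]
    rw [this]
    exact (rRing σ).add_mem (hg h hh) (hg' h hh)
  smul_mem' := by
    intro r g hg h hh
    have : pairing ρ α t w (r • g) h = r • pairing ρ α t w g h := by
      simp [pairing, Finset.smul_sum]
    rw [this]
    exact (rRing σ).mul_mem r.2 (hg h hh)

end Modules

/-! ### Gradings and graded homomorphisms -/

section Graded

variable {k : Type*} [Field k] {V : Type*} [AddCommGroup V] [Module k V]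
  {σ : Submonoid (SymmetricAlgebra k V)} {E : Type*}

/-- The homogeneous part `N_i` of a submodule `N` of the module of functions `E → Q`. -/
def modGr (N : Submodule (rRing σ) (E → QRing k V)) (i : ℤ) : AddSubgroup (E → QRing k V) where
  carrier := {g | g ∈ N ∧ ∀ e, g e ∈ qGr k V i}
  zero_mem' := ⟨N.zero_mem, fun _ => (qGr k V i).zero_mem⟩
  add_mem' := fun hg hh =>
    ⟨N.add_mem hg.1 hh.1, fun e => (qGr k V i).add_mem (hg.2 e) (hh.2 e)⟩
  neg_mem' := fun hg => ⟨N.neg_mem hg.1, fun e => (qGr k V i).neg_mem (hg.2 e)⟩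

/-- `N` is a graded submodule: it is the sum of its homogeneous parts. -/
def IsGradedSubmodule (N : Submodule (rRing σ) (E → QRing k V)) : Prop :=
  N.toAddSubgroup = ⨆ i : ℤ, modGr N i

/-- The group `Hom^m(N, R)` of all homomorphisms `φ : N → R` of `R`-modules of degree `m`, that is,
`φ(N_i) ⊆ R_{m + i}` for all `i`. -/
def homDeg (N : Submodule (rRing σ) (E → QRing k V)) (m : ℤ) :
    AddSubgroup (N →ₗ[rRing σ] rRing σ) where
  carrier := {φ | ∀ (i : ℤ) (x : N), (x : E → QRing k V) ∈ modGr N i →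
    (φ x : QRing k V) ∈ qGr k V (m + i)}
  zero_mem' := fun i _ _ => (qGr k V (m + i)).zero_mem
  add_mem' := fun hφ hψ i x hx => (qGr k V (m + i)).add_mem (hφ i x hx) (hψ i x hx)
  neg_mem' := fun hφ i x hx => (qGr k V (m + i)).neg_mem (hφ i x hx)

/-- The graded module of homomorphisms `Hom^•(N, R) = ⨁ m, Hom^m(N, R)`, inside `Hom(N, R)`.
It is written as an `R`-span, which is just the sum of the groups `Hom^m(N, R)`, see
`homGr_toAddSubgroup`. -/
def homGr (N : Submodule (rRing σ) (E → QRing k V)) :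
    Submodule (rRing σ) (N →ₗ[rRing σ] rRing σ) :=
  Submodule.span (rRing σ) (⋃ m : ℤ, (homDeg N m : Set (N →ₗ[rRing σ] rRing σ)))

/-- `Hom^•(N, R)` is the sum of its homogeneous parts. -/
theorem homGr_toAddSubgroup (hσ : ∀ s ∈ σ, ∃ i, s ∈ symGr k V i)
    (h0 : (0 : SymmetricAlgebra k V) ∉ σ) (N : Submodule (rRing σ) (E → QRing k V)) :
    (homGr N).toAddSubgroup = ⨆ m : ℤ, homDeg N m := by
  have key : ∀ s ∈ σ, ∀ p : SymmetricAlgebra k V, ∀ r : rRing σ,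
      algebraMap _ (QRing k V) s * r = algebraMap _ (QRing k V) p →
      ∀ m, ∀ φ ∈ homDeg N m, r • φ ∈ ⨆ m : ℤ, homDeg N m := by
    intro s hs p
    obtain ⟨b, hb⟩ := hσ s hs
    have hs0 : s ≠ 0 := fun h => h0 (h ▸ hs)
    have hu : IsUnit (algebraMap _ (QRing k V) s) :=
      IsLocalization.map_units (QRing k V) (⟨s, hs0, b, hb⟩ : homNonzero k V)
    have hp : p ∈ ⨆ i : ℤ, symGr k V i := by rw [iSup_symGr]; trivial
    induction hp using Submodule.iSup_induction' with
    | mem i p hp =>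
      intro r hr m φ hφ
      refine AddSubgroup.mem_iSup_of_mem (i - b + m) fun j x hx => ?_
      obtain ⟨a', b', p', s', hp', hs', hs0', hab', hx'⟩ := hφ j x hx
      refine ⟨i + a', b + b', p * p', s * s', mul_mem_symGr hp hp', mul_mem_symGr hb hs',
        mul_ne_zero hs0 hs0', by omega, ?_⟩
      rw [map_mul, map_mul, ← hr, ← hx']
      simp only [LinearMap.smul_apply, smul_eq_mul, Subring.coe_mul]
      ring
    | zero =>
      intro r hr m φ hφ
      have : r = 0 := by
        rw [map_zero] at hr
        exact Subtype.ext ((hu.mul_right_eq_zero).1 hr)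
      rw [this, zero_smul]
      exact zero_mem _
    | add p q _ _ ihp ihq =>
      intro r hr m φ hφ
      obtain ⟨u, hu⟩ := hu
      have hR : ∀ p : SymmetricAlgebra k V, algebraMap _ (QRing k V) s * (↑u⁻¹ * algebraMap _ (QRing k V) p) =
          algebraMap _ (QRing k V) p := fun p => by rw [← hu, Units.mul_inv_cancel_left]
      let f : SymmetricAlgebra k V → rRing σ := fun p =>
        ⟨↑u⁻¹ * algebraMap (SymmetricAlgebra k V) (QRing k V) p, s, hs, p, hR p⟩
      have : r = f p + f q := by
        refine Subtype.ext (u.isUnit.mul_left_cancel ?_)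
        rw [hu, hr, Subring.coe_add, mul_add, map_add, hR p, hR q]
      rw [this, add_smul]
      exact add_mem (ihp _ (hR p) m φ hφ) (ihq _ (hR q) m φ hφ)
  have smul : ∀ r : rRing σ, ∀ φ ∈ ⨆ m : ℤ, homDeg N m, r • φ ∈ ⨆ m : ℤ, homDeg N m := by
    intro r φ hφ
    obtain ⟨s, hs, p, hr⟩ := r.2
    induction hφ using AddSubgroup.iSup_induction' with
    | hp m φ hφ => exact key s hs p r hr m φ hφ
    | h1 => rw [smul_zero]; exact zero_mem _
    | hadd φ ψ _ _ ihφ ihψ => rw [smul_add]; exact add_mem ihφ ihψ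
  refine le_antisymm (fun φ hφ => ?_) (iSup_le fun m φ hφ => ?_)
  · refine Submodule.span_induction (p := fun φ _ => φ ∈ ⨆ m : ℤ, homDeg N m)
      ?_ (zero_mem _) (fun _ _ _ _ => add_mem) (fun r φ _ => smul r φ) hφ
    intro φ hφ
    obtain ⟨m, hm⟩ := Set.mem_iUnion.1 hφ
    exact AddSubgroup.mem_iSup_of_mem m hm
  · exact Submodule.subset_span (Set.mem_iUnion.2 ⟨m, hφ⟩)

end Graded

end BottSamelson

end

/-! Divisibility is tested one root at a time. Each `α_p` is a prime of `Sym V` dividing no element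
of `σ`, so an element of `Q` that a product of roots carries into `R` lies in `R` as soon as, for
every `p`, it has a denominator prime to `α_p` (`mem_rRing_of_prod_mul`).

Fix `p`. The flips `f_Y ε` with `Y ⊆ M = M_p(ε)` form a cube on which `M_p` is constant, and these
cubes partition the subexpressions. The target of `f_Y ε` is `p^|Y|` times that of `ε`, so a cube
that meets `Sub(t, w)` meets it in a half cube: the even `Y`, seen from a base point in `Sub(t, w)`.

The signs `chi X Y = (-1)^{|Y|_X}` are multiplicative for symmetric differences in both arguments,
and the `chi I`, `I ⊆ M`, are the characters of the group of subsets of `M`. As `2` is invertible,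
divisibility of all alternating sums by `α_p^{e |X|}`, `e` monotone, amounts locally to divisibility
of the Fourier coefficients at `I` by `α_p^{e |I|}` (`fourierDvd_of_sum_mem`, `FourierDvd.sum_mem`).
For `e = id` this condition is stable under products.

On a half cube, `o(f_Y ε)` is a nonzero constant times `α_p^|M| chi M Y` times a factor which,
together with its inverse, satisfies the condition for `e = id`; the inverse is where the
GKM-condition enters. So a cube contributes to `⟨g|h⟩` essentially `α_p^{-|M|}` times a Fourier
coefficient at `M` of a product, that is, a convolution over `I` of coefficients of `g` at `I` and
of `h` (corrected by the inverse factor) at `M \ I`. The exponents `|I| - 1` and `|M| - |I|` seem to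
fall short by one. But parity is the character `chi {max M}`, so functions on a half cube have equal
coefficients at `I` and at `symmDiff I {max M}`, which supplies the missing factor
(`FourierDvd.fourier_mul_mem`). Thus `X_w` and `X^w` pair into `R` (`pairing_mem`).

Conversely, a function on one cube built from a single character, a power of `α_p` and the remaining
factor of `o`, multiplied by many other roots, lies in `X(t)`, and pairing with it isolates one
Fourier coefficient of `g` (`fourier_mem_of_pairing_mem`). This gives `D Y_w ⊆ X^w`. Cutting the
test function down to the half cube costs one more `α_p` and gives `D X^w ⊆ X_w`. The dualities
follow with `X^w ⊆ Y_w ⊆ X_w`.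

Finally, the modules in question contain a multiple of every delta function, so each linear map to
`R` is the pairing with a unique function, which lies in the dual module (`pairHom_surjective`). The
dual modules are stable under homogeneous components, so all these maps lie in the graded Hom; the
shift is the degree `2n` of `o`. -/

noncomputable section

namespace BottSamelson

open SymmetricAlgebra Finset

/-! ### Submodules generated by powers -/

section PowMod

variable {Q : Type*} [CommRing Q]

/-- The submodule `a ^ m A` of a ring `Q`, for a subring `A` of `Q`. -/
def powMod (A : Subring Q) (a : Q) (m : ℕ) : Submodule A Q := Submodule.span A {a ^ m}

variable {A : Subring Q} {a : Q}

theorem mem_powMod {m : ℕ} {x : Q} : x ∈ powMod A a m ↔ ∃ r ∈ A, x = a ^ m * r := by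
  rw [powMod, Submodule.mem_span_singleton]
  constructor
  · rintro ⟨r, rfl⟩
    exact ⟨r, r.2, by rw [mul_comm]; rfl⟩
  · rintro ⟨r, hr, rfl⟩
    exact ⟨⟨r, hr⟩, by rw [mul_comm]; rfl⟩

theorem powMod_zero {x : Q} : x ∈ powMod A a 0 ↔ x ∈ A := by
  simp [mem_powMod]

theorem mul_mem_powMod {m l : ℕ} {x y : Q} (hx : x ∈ powMod A a m) (hy : y ∈ powMod A a l) :
    x * y ∈ powMod A a (m + l) := by
  obtain ⟨r, hr, rfl⟩ := mem_powMod.1 hx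
  obtain ⟨s, hs, rfl⟩ := mem_powMod.1 hy
  exact mem_powMod.2 ⟨r * s, A.mul_mem hr hs, by ring⟩

theorem mul_mem_powMod_left {m : ℕ} {x y : Q} (hx : x ∈ A) (hy : y ∈ powMod A a m) :
    x * y ∈ powMod A a m := by
  simpa using mul_mem_powMod (powMod_zero.2 hx) hy

theorem pow_mem_powMod (m : ℕ) : a ^ m ∈ powMod A a m := mem_powMod.2 ⟨1, A.one_mem, by simp⟩

theorem powMod_anti (ha : a ∈ A) {m l : ℕ} (h : m ≤ l) : powMod A a l ≤ powMod A a m := by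
  intro x hx
  obtain ⟨r, hr, rfl⟩ := mem_powMod.1 hx
  obtain ⟨c, rfl⟩ := Nat.exists_eq_add_of_le h
  exact mem_powMod.2 ⟨a ^ c * r, A.mul_mem (A.pow_mem ha c) hr, by ring⟩

theorem mem_of_mem_powMod (ha : a ∈ A) {m : ℕ} {x : Q} (hx : x ∈ powMod A a m) : x ∈ A :=
  powMod_zero.1 (powMod_anti ha m.zero_le hx)

/-- Cancellation of a unit power of `a`. -/
theorem mem_powMod_of_pow_mul (hu : IsUnit a) {m l : ℕ} {x : Q}
    (h : a ^ l * x ∈ powMod A a (l + m)) : x ∈ powMod A a m := by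
  obtain ⟨r, hr, h⟩ := mem_powMod.1 h
  exact mem_powMod.2 ⟨r, hr, (hu.pow l).mul_left_cancel (by rw [h]; ring)⟩

end PowMod

/-! ### Characters and Fourier coefficients -/

section Fourier

variable (Q : Type*) [CommRing Q] {n : ℕ}

/-- The sign `(-1)^{|Y|_X}`. -/
def chi (X Y : Finset (Fin n)) : Q := (-1) ^ relCard X Y

/-- One sign for each pair `y ≤ x`; in this form multiplicativity in `X` and in `Y` is visible at
once. -/
theorem chi_eq_prod (X Y : Finset (Fin n)) :
    chi Q X Y = ∏ y ∈ Y, ∏ x ∈ X, if y ≤ x then (-1 : Q) else 1 := by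
  rw [chi, relCard, ← prod_const, prod_filter]
  refine prod_congr rfl fun y _ => ?_
  rw [← prod_filter, prod_const]
  split_ifs with h
  · exact h.neg_one_pow.symm
  · exact (Nat.not_odd_iff_even.1 h).neg_one_pow.symm

variable {Q}

theorem prod_symmDiff {ι : Type*} [DecidableEq ι] {f : ι → Q} (hf : ∀ i, f i * f i = 1)
    (A B : Finset ι) : ∏ i ∈ symmDiff A B, f i = (∏ i ∈ A, f i) * ∏ i ∈ B, f i := by
  have h1 := prod_inter_mul_prod_sdiff A B f
  have h2 := prod_inter_mul_prod_sdiff B A f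
  have h3 : (∏ i ∈ A ∩ B, f i) * ∏ i ∈ A ∩ B, f i = 1 := by
    rw [← prod_mul_distrib]
    exact prod_eq_one fun i _ => hf i
  rw [inter_comm] at h2
  rw [← h1, ← h2, symmDiff_def, sup_eq_union, prod_union disjoint_sdiff_sdiff]
  linear_combination (-(∏ i ∈ A \ B, f i) * ∏ i ∈ B \ A, f i) * h3

theorem chi_symmDiff_right (X Y Z : Finset (Fin n)) :
    chi Q X (symmDiff Y Z) = chi Q X Y * chi Q X Z := by
  simp only [chi_eq_prod]
  refine prod_symmDiff (fun y => ?_) Y Z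
  rw [← prod_mul_distrib]
  exact prod_eq_one fun x _ => by split_ifs <;> simp

theorem chi_symmDiff_left (X Y Z : Finset (Fin n)) :
    chi Q (symmDiff X Y) Z = chi Q X Z * chi Q Y Z := by
  simp only [chi_eq_prod, ← prod_mul_distrib]
  exact prod_congr rfl fun z _ => prod_symmDiff (fun x => by split_ifs <;> simp) X Y

theorem chi_mul_self (X Y : Finset (Fin n)) : chi Q X Y * chi Q X Y = 1 := by
  rw [chi, ← pow_add, Even.neg_one_pow ⟨_, rfl⟩]

theorem chi_empty_left (Y : Finset (Fin n)) : chi Q ∅ Y = 1 := by simp [chi_eq_prod]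

theorem chi_mem (A : Subring Q) (X Y : Finset (Fin n)) : chi Q X Y ∈ A :=
  A.pow_mem (A.neg_mem A.one_mem) _

/-- Parity of `|Y|` is itself a character, with a one-element index. This gives Fourier analysis
access to half cubes. -/
theorem chi_singleton_max {M Y : Finset (Fin n)} {m : Fin n} (hm : ∀ y ∈ M, y ≤ m) (hY : Y ⊆ M) :
    chi Q {m} Y = (-1) ^ Y.card := by
  rw [chi_eq_prod, ← prod_const]
  exact prod_congr rfl fun y hy => by simp [hm y (hY hy)]

/-! ### Orthogonality of characters and Fourier inversion. -/

theorem sum_powerset_prod_eq_zero {ι : Type*} [DecidableEq ι] {X : Finset ι} {f : ι → Q} {y : ι}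
    (hy : y ∈ X) (h : f y = -1) : ∑ Y ∈ X.powerset, ∏ y ∈ Y, f y = 0 := by
  rw [← prod_one_add]
  exact prod_eq_zero hy (by rw [h]; ring)

/-- The sum factors over `M`, and the factor at `max I` is `1 + (-1)`, since no other element of `I`
lies above it. In `sum_chi_right` the minimum of `Y` plays this role. -/
theorem sum_chi_left {M I : Finset (Fin n)} (hI : I ⊆ M) (h0 : I.Nonempty) :
    ∑ Y ∈ M.powerset, chi Q I Y = 0 := by
  simp only [chi_eq_prod]
  refine sum_powerset_prod_eq_zero (hI (I.max'_mem h0)) ?_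
  rw [prod_eq_single (I.max' h0)]
  · simp
  · intro x hx hne
    rw [if_neg]
    exact not_le.2 (lt_of_le_of_ne (I.le_max' x hx) hne)
  · exact fun h => absurd (I.max'_mem h0) h

theorem sum_chi_right {M Y : Finset (Fin n)} (hY : Y ⊆ M) (h0 : Y.Nonempty) :
    ∑ I ∈ M.powerset, chi Q I Y = 0 := by
  simp only [chi_eq_prod]
  simp_rw [prod_comm (s := Y)]
  refine sum_powerset_prod_eq_zero (hY (Y.min'_mem h0)) ?_
  rw [prod_eq_single (Y.min' h0)]
  · simp
  · intro x hx hne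
    rw [if_neg]
    exact not_le.2 (lt_of_le_of_ne (Y.min'_le x hx) hne.symm)
  · exact fun h => absurd (Y.min'_mem h0) h

theorem sum_powerset_symmDiff {M Z : Finset (Fin n)} (hZ : Z ⊆ M) (F : Finset (Fin n) → Q) :
    ∑ Y ∈ M.powerset, F (symmDiff Y Z) = ∑ Y ∈ M.powerset, F Y := by
  have h : ∀ Y ∈ M.powerset, symmDiff Y Z ∈ M.powerset := fun Y hY =>
    mem_powerset.2 ((symmDiff_le_sup (a := Y) (b := Z)).trans (union_subset (mem_powerset.1 hY) hZ))
  exact sum_bij' (fun Y _ => symmDiff Y Z) (fun Y _ => symmDiff Y Z) h h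
    (fun Y _ => symmDiff_symmDiff_cancel_right _ _) (fun Y _ => symmDiff_symmDiff_cancel_right _ _)
    (fun Y _ => rfl)

/-- The unnormalized Fourier coefficients of a function on the subsets of `M`. -/
def fourier (M : Finset (Fin n)) (G : Finset (Fin n) → Q) (I : Finset (Fin n)) : Q :=
  ∑ Y ∈ M.powerset, chi Q I Y * G Y

theorem fourier_congr {M : Finset (Fin n)} {G H : Finset (Fin n) → Q} (h : ∀ Y ⊆ M, G Y = H Y)
    (I : Finset (Fin n)) : fourier M G I = fourier M H I :=
  sum_congr rfl fun Y hY => by rw [h Y (mem_powerset.1 hY)]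

theorem fourier_chi_mul (M J : Finset (Fin n)) (G : Finset (Fin n) → Q) (I : Finset (Fin n)) :
    fourier M (fun Y => chi Q J Y * G Y) I = fourier M G (symmDiff I J) :=
  sum_congr rfl fun Y _ => by rw [chi_symmDiff_left]; ring

theorem fourier_const_mul (M : Finset (Fin n)) (c : Q) (G : Finset (Fin n) → Q)
    (I : Finset (Fin n)) : fourier M (fun Y => c * G Y) I = c * fourier M G I := by
  rw [fourier, fourier, mul_sum]
  exact sum_congr rfl fun Y _ => by ring

theorem fourier_add (M : Finset (Fin n)) (G H : Finset (Fin n) → Q)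
    (I : Finset (Fin n)) : fourier M (fun Y => G Y + H Y) I = fourier M G I + fourier M H I := by
  simp only [fourier, mul_add, sum_add_distrib]

theorem fourier_inversion {M Y : Finset (Fin n)} (hY : Y ⊆ M) (G : Finset (Fin n) → Q) :
    ∑ I ∈ M.powerset, fourier M G I * chi Q I Y = 2 ^ M.card * G Y := by
  simp only [fourier, sum_mul]
  rw [sum_comm, sum_eq_single Y]
  · have : ∀ I, chi Q I Y * G Y * chi Q I Y = G Y := fun I => by
      linear_combination G Y * chi_mul_self (Q := Q) I Y
    simp only [this, sum_const, card_powerset, nsmul_eq_mul]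
    push_cast
    ring
  · intro Z hZ hne
    have : ∀ I : Finset (Fin n), chi Q I Z * G Z * chi Q I Y = chi Q I (symmDiff Z Y) * G Z :=
      fun I => by rw [chi_symmDiff_right]; ring
    simp only [this]
    rw [← sum_mul, sum_chi_right, zero_mul]
    · exact symmDiff_le_sup.trans (union_subset (mem_powerset.1 hZ) hY)
    · rw [nonempty_iff_ne_empty]
      exact fun h => hne (symmDiff_eq_bot.1 h)
  · exact fun h => absurd (mem_powerset.2 hY) h

/-- Inserting Fourier inversion for `G` turns the convolution of coefficients into the coefficient
of the product. -/
theorem fourier_mul (M : Finset (Fin n)) (G H : Finset (Fin n) → Q) (K : Finset (Fin n)) :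
    ∑ I ∈ M.powerset, fourier M G I * fourier M H (symmDiff K I) =
      2 ^ M.card * fourier M (fun Y => G Y * H Y) K := by
  have : ∀ I, fourier M G I * fourier M H (symmDiff K I) =
      ∑ Y ∈ M.powerset, chi Q K Y * H Y * (fourier M G I * chi Q I Y) := fun I => by
    rw [fourier, fourier, mul_sum]
    exact sum_congr rfl fun Y _ => by rw [chi_symmDiff_left]; ring
  simp only [this]
  rw [sum_comm, fourier, mul_sum]
  refine sum_congr rfl fun Y hY => ?_
  rw [← mul_sum, fourier_inversion (mem_powerset.1 hY)]
  ring

/-- Parities of the counting functions of `I` and `X` agreeing on `X` force `|X| ≤ |I|`. -/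
theorem card_le_of_parity (I : Finset (Fin n)) (X : Finset (Fin n)) :
    (∀ y ∈ X, (Even (I.filter (y ≤ ·)).card ↔ Even (X.filter (y ≤ ·)).card)) →
      ∀ b, (∀ x ∈ X, b ≤ x) → X.card ≤ (I.filter (b ≤ ·)).card := by
  induction X using Finset.induction_on_min with
  | empty => simp
  | insert x X hx ih =>
    intro h b hb
    have hxX : x ∉ X := fun h => lt_irrefl _ (hx x h)
    have h1 : X.card ≤ (I.filter (x ≤ ·)).card := by
      refine ih (fun y hy => ?_) x fun y hy => (hx y hy).le
      rw [h y (mem_insert_of_mem hy), filter_insert, if_neg (not_le.2 (hx y hy))]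
    have h2 := h x (mem_insert_self x X)
    have h3 : (insert x X).filter (x ≤ ·) = insert x X := by
      refine filter_true_of_mem fun y hy => ?_
      rcases mem_insert.1 hy with rfl | hy
      · exact le_rfl
      · exact (hx y hy).le
    rw [h3, card_insert_of_notMem hxX, Nat.even_add_one] at h2
    have h4 : (I.filter (x ≤ ·)).card ≤ (I.filter (b ≤ ·)).card :=
      card_le_card (monotone_filter_right _ fun y _ hy => (hb x (mem_insert_self x X)).trans hy)
    -- The parity at the minimum `x`, namely that of `|X| + 1`, excludes equality in `h1`; this
    -- gains the extra `1`.
    have h5 : X.card ≠ (I.filter (x ≤ ·)).card := fun h => by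
      rw [h] at h2
      exact iff_not_self h2
    rw [card_insert_of_notMem hxX]
    omega

/-- The character `chi X * chi I` is nontrivial on subsets of `X`: otherwise the parities agree at
every `y ∈ X`, and `card_le_of_parity` gives `|X| ≤ |I|`. -/
theorem sum_chi_mul_chi_eq_zero {I X : Finset (Fin n)} (h : I.card < X.card) :
    ∑ Y ∈ X.powerset, chi Q X Y * chi Q I Y = 0 := by
  simp only [chi_eq_prod, ← prod_mul_distrib]
  by_cases hc : ∀ y ∈ X, (Even (I.filter (y ≤ ·)).card ↔ Even (X.filter (y ≤ ·)).card)
  · have h0 : X.Nonempty := card_pos.1 (by omega)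
    have := card_le_of_parity I X hc (X.min' h0) fun x hx => X.min'_le x hx
    have := card_filter_le I (X.min' h0 ≤ ·)
    omega
  · push Not at hc
    obtain ⟨y, hy, hy'⟩ := hc
    refine sum_powerset_prod_eq_zero hy ?_
    simp only [← prod_filter, prod_const]
    rcases hy' with ⟨h1, h2⟩ | ⟨h1, h2⟩
    · rw [h1.neg_one_pow, (Nat.not_even_iff_odd.1 h2).neg_one_pow]; simp
    · rw [h2.neg_one_pow, (Nat.not_even_iff_odd.1 h1).neg_one_pow]; simp

end Fourier

/-! ### Functions on a cube with divisible Fourier coefficients -/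

section FourierDvd

variable {Q : Type*} [CommRing Q] {n : ℕ}

/-- The Fourier coefficients at `I` are divisible by `a ^ e |I|`. -/
def FourierDvd (A : Subring Q) (a : Q) (M : Finset (Fin n)) (e : ℕ → ℕ)
    (G : Finset (Fin n) → Q) : Prop :=
  ∀ I ⊆ M, fourier M G I ∈ powMod A a (e I.card)

variable {A : Subring Q} {a r : Q} {M : Finset (Fin n)} {e : ℕ → ℕ} {G H : Finset (Fin n) → Q}

theorem symmDiff_subset {X Y M : Finset (Fin n)} (hX : X ⊆ M) (hY : Y ⊆ M) : symmDiff X Y ⊆ M :=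
  symmDiff_le_sup.trans (union_subset hX hY)

theorem card_symmDiff_le (X Y : Finset (Fin n)) : (symmDiff X Y).card ≤ X.card + Y.card :=
  (card_le_card symmDiff_le_sup).trans (card_union_le X Y)

theorem mem_of_two_pow_mul {P : Submodule A Q} (hr : r ∈ A) (h2 : 2 * r = 1) {m : ℕ} {x : Q}
    (h : 2 ^ m * x ∈ P) : x ∈ P := by
  have := P.smul_mem ⟨r ^ m, A.pow_mem hr m⟩ h
  have h3 : (⟨r ^ m, A.pow_mem hr m⟩ : A) • (2 ^ m * x) = x := by
    change r ^ m * (2 ^ m * x) = x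
    rw [← mul_assoc, ← mul_pow, mul_comm r, h2, one_pow, one_mul]
  rwa [h3] at this

theorem FourierDvd.congr (hG : FourierDvd A a M e G) (h : ∀ Y ⊆ M, G Y = H Y) :
    FourierDvd A a M e H := fun I hI => by
  rw [← fourier_congr h]
  exact hG I hI

/-- Expand `G` in characters. Those with `|I| < |X|` have vanishing alternating sum over the
`X`-cube; the others have coefficients divisible by `a ^ e |I|`, hence by `a ^ e |X|`. -/
theorem FourierDvd.sum_mem (ha : a ∈ A) (hr : r ∈ A) (h2 : 2 * r = 1) (he : Monotone e)
    (hG : FourierDvd A a M e G) {X Z : Finset (Fin n)} (hX : X ⊆ M) (hZ : Z ⊆ M) :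
    ∑ Y ∈ X.powerset, chi Q X Y * G (symmDiff Y Z) ∈ powMod A a (e X.card) := by
  refine mem_of_two_pow_mul hr h2 (m := M.card) ?_
  have : 2 ^ M.card * ∑ Y ∈ X.powerset, chi Q X Y * G (symmDiff Y Z) =
      ∑ I ∈ M.powerset, (chi Q I Z * ∑ Y ∈ X.powerset, chi Q X Y * chi Q I Y) *
        fourier M G I := by
    simp only [mul_sum, sum_mul]
    rw [sum_comm]
    refine sum_congr rfl fun Y hY => ?_
    have := fourier_inversion (symmDiff_subset ((mem_powerset.1 hY).trans hX) hZ) G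
    rw [mul_left_comm, ← this, mul_sum]
    exact sum_congr rfl fun I _ => by rw [chi_symmDiff_right]; ring
  rw [this]
  refine Submodule.sum_mem _ fun I hI => ?_
  by_cases h : I.card < X.card
  · rw [sum_chi_mul_chi_eq_zero h, mul_zero, zero_mul]
    exact Submodule.zero_mem _
  · refine mul_mem_powMod_left ?_ (powMod_anti ha (he (not_lt.1 h)) (hG I (mem_powerset.1 hI)))
    exact A.mul_mem (chi_mem A _ _) (A.sum_mem fun Y _ => A.mul_mem (chi_mem A _ _) (chi_mem A _ _))

theorem FourierDvd.apply_mem (ha : a ∈ A) (hr : r ∈ A) (h2 : 2 * r = 1) (he : Monotone e)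
    (hG : FourierDvd A a M e G) {Z : Finset (Fin n)} (hZ : Z ⊆ M) : G Z ∈ A := by
  have := mem_of_mem_powMod ha (hG.sum_mem ha hr h2 he (empty_subset M) hZ)
  have h0 : symmDiff ∅ Z = Z := bot_symmDiff Z
  simpa [chi_empty_left, h0] using this

/-- Sum over all base points `Z` with weight `chi I Z`: after translation by `Y`, each of the
`2^|I|` sets `Y ⊆ I` contributes the full coefficient at `I`. -/
theorem fourierDvd_of_sum_mem (hr : r ∈ A) (h2 : 2 * r = 1)
    (h : ∀ X ⊆ M, ∀ Z ⊆ M,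
      ∑ Y ∈ X.powerset, chi Q X Y * G (symmDiff Y Z) ∈ powMod A a (e X.card)) :
    FourierDvd A a M e G := fun I hI => by
  refine mem_of_two_pow_mul hr h2 (m := I.card) ?_
  have : 2 ^ I.card * fourier M G I = ∑ Z ∈ M.powerset,
      chi Q I Z * ∑ Y ∈ I.powerset, chi Q I Y * G (symmDiff Y Z) := by
    simp only [mul_sum]
    rw [sum_comm]
    have : ∀ Y ∈ I.powerset,
        ∑ Z ∈ M.powerset, chi Q I Z * (chi Q I Y * G (symmDiff Y Z)) = fourier M G I := by
      intro Y hY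
      rw [fourier, ← sum_powerset_symmDiff ((mem_powerset.1 hY).trans hI)]
      refine sum_congr rfl fun Z _ => ?_
      rw [chi_symmDiff_right, symmDiff_comm Y, symmDiff_symmDiff_cancel_right]
      linear_combination chi Q I Z * G Z * chi_mul_self (Q := Q) I Y
    rw [sum_congr rfl this, sum_const, card_powerset, nsmul_eq_mul]
    push_cast
    ring
  rw [this]
  exact Submodule.sum_mem _ fun Z hZ =>
    mul_mem_powMod_left (chi_mem A _ _) (h I hI Z (mem_powerset.1 hZ))

theorem FourierDvd.add (hG : FourierDvd A a M e G) (hH : FourierDvd A a M e H) :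
    FourierDvd A a M e fun Y => G Y + H Y := fun I hI => by
  rw [fourier_add]
  exact Submodule.add_mem _ (hG I hI) (hH I hI)

/-- Each term of the convolution is divisible enough because `|K| ≤ |I| + |symmDiff K I|`. -/
theorem FourierDvd.mul (ha : a ∈ A) (hr : r ∈ A) (h2 : 2 * r = 1)
    (hG : FourierDvd A a M id G) (hH : FourierDvd A a M id H) :
    FourierDvd A a M id fun Y => G Y * H Y := fun K hK => by
  refine mem_of_two_pow_mul hr h2 (m := M.card) ?_
  rw [← fourier_mul]
  refine Submodule.sum_mem _ fun I hI => ?_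
  have hI := mem_powerset.1 hI
  refine powMod_anti ha ?_ (mul_mem_powMod (hG I hI) (hH _ (symmDiff_subset hK hI)))
  have := card_symmDiff_le I (symmDiff K I)
  rwa [symmDiff_comm I, symmDiff_symmDiff_cancel_right] at this

/-- By orthogonality the only nonzero coefficient can be the one at `J`. -/
theorem fourierDvd_chi {J : Finset (Fin n)} (hJ : J ⊆ M) {c : Q} (hc : c ∈ powMod A a J.card) :
    FourierDvd A a M id fun Y => c * chi Q J Y := fun I hI => by
  have h1 : fourier M (fun Y => c * chi Q J Y) I = c * fourier M (fun Y => 1) (symmDiff I J) := by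
    rw [fourier_const_mul, ← fourier_chi_mul]
    simp
  rw [h1]
  by_cases h : I = J
  · subst h
    rw [mul_comm]
    refine mul_mem_powMod_left (A.sum_mem fun Y _ => ?_) hc
    exact A.mul_mem (chi_mem A _ _) A.one_mem
  · have : fourier M (fun _ => (1 : Q)) (symmDiff I J) = 0 := by
      simp only [fourier, mul_one]
      refine sum_chi_left (symmDiff_subset hI hJ) ?_
      rw [nonempty_iff_ne_empty]
      exact fun h0 => h (symmDiff_eq_bot.1 h0)
    rw [this, mul_zero]
    exact Submodule.zero_mem _

theorem fourierDvd_const {c : Q} (hc : c ∈ A) : FourierDvd A a M id fun _ => c := by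
  have := fourierDvd_chi (A := A) (a := a) (empty_subset M) (c := c) (by simpa [powMod_zero])
  simpa only [chi_empty_left, mul_one] using this

theorem FourierDvd.prod (ha : a ∈ A) (hr : r ∈ A) (h2 : 2 * r = 1) {ι : Type*} (s : Finset ι)
    {F : ι → Finset (Fin n) → Q} (h : ∀ i ∈ s, FourierDvd A a M id (F i)) :
    FourierDvd A a M id fun Y => ∏ i ∈ s, F i Y := by
  classical
  induction s using Finset.induction_on with
  | empty => simpa using fourierDvd_const A.one_mem
  | insert i s hi ih =>
    simp only [prod_insert hi]
    exact (h i (mem_insert_self i s)).mul ha hr h2 (ih fun j hj => h j (mem_insert_of_mem hj))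

/-- `J` consists of the largest element of `M` below `i`, if there is one: for `Y ⊆ M`, lying below
`i` means being at most that element. -/
theorem neg_one_pow_card_filter_lt (M : Finset (Fin n)) (i : Fin n) :
    ∃ J ⊆ M, J.card ≤ 1 ∧ ∀ Y ⊆ M, (-1 : Q) ^ (Y.filter (· < i)).card = chi Q J Y := by
  by_cases h : (M.filter (· < i)).Nonempty
  · have hm := mem_filter.1 (max'_mem _ h)
    refine ⟨{(M.filter (· < i)).max' h}, singleton_subset_iff.2 hm.1, by simp, fun Y hY => ?_⟩
    rw [chi_eq_prod, ← prod_const, prod_filter]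
    refine prod_congr rfl fun y hy => ?_
    have : y < i ↔ y ≤ (M.filter (· < i)).max' h :=
      ⟨fun hlt => le_max' _ _ (mem_filter.2 ⟨hY hy, hlt⟩), fun hle => hle.trans_lt hm.2⟩
    simp [this]
  · refine ⟨∅, empty_subset _, by simp, fun Y hY => ?_⟩
    rw [not_nonempty_iff_eq_empty] at h
    have : Y.filter (· < i) = ∅ :=
      subset_empty.1 (h ▸ filter_subset_filter _ hY)
    rw [this, chi_empty_left, card_empty, pow_zero]

/-- A sequence of period two is its mean plus half the difference times a sign. That sign is a
character with `|J| ≤ 1`, so one factor `a` in the difference suffices. -/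
theorem fourierDvd_parity (ha : a ∈ A) (hr : r ∈ A) (h2 : 2 * r = 1) (i : Fin n)
    {v : ℕ → Q} (h0 : v 0 ∈ A) (h01 : v 0 - v 1 ∈ powMod A a 1) (hv : ∀ m, v (m + 2) = v m) :
    FourierDvd A a M id fun Y => v (Y.filter (· < i)).card := by
  obtain ⟨J, hJM, hJ, hY⟩ := neg_one_pow_card_filter_lt (Q := Q) M i
  have h1 : v 1 ∈ A := by
    have := A.sub_mem h0 (mem_of_mem_powMod ha h01)
    rwa [sub_sub_cancel] at this
  have hc : r * (v 0 - v 1) ∈ powMod A a J.card :=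
    powMod_anti ha hJ (mul_mem_powMod_left hr h01)
  refine ((fourierDvd_const (A.mul_mem hr (A.add_mem h0 h1))).add
    (fourierDvd_chi hJM hc)).congr fun Y hYM => ?_
  rw [← hY Y hYM]
  have key : ∀ m, v m = if Even m then v 0 else v 1 := by
    intro m
    induction m using Nat.strong_induction_on with
    | _ m ih =>
      match m with
      | 0 => simp
      | 1 => simp
      | m + 2 => rw [hv, ih m (by omega)]; simp [Nat.even_add]
  rw [key (Y.filter (· < i)).card]
  split_ifs with h
  · rw [h.neg_one_pow]; linear_combination v 0 * h2
  · rw [(Nat.not_even_iff_odd.1 h).neg_one_pow]; linear_combination v 1 * h2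

/-- Multiplication by the parity character `chi {m}` fixes functions on even subsets, and it shifts
the index of Fourier coefficients by `{m}`. -/
theorem fourier_symmDiff_max {m : Fin n} (hm : ∀ y ∈ M, y ≤ m)
    (hG : ∀ Y ⊆ M, ¬ Even Y.card → G Y = 0) (I : Finset (Fin n)) :
    fourier M G (symmDiff I {m}) = fourier M G I := by
  rw [← fourier_chi_mul]
  refine fourier_congr (fun Y hY => ?_) I
  by_cases h : Even Y.card
  · rw [chi_singleton_max hm hY, h.neg_one_pow, one_mul]
  · rw [hG Y hY h, mul_zero]

theorem card_symmDiff_singleton {m : Fin n} (I : Finset (Fin n)) :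
    (symmDiff I {m}).card = if m ∈ I then I.card - 1 else I.card + 1 := by
  split_ifs with h
  · rw [symmDiff_of_ge (singleton_subset_iff.2 h), sdiff_singleton_eq_erase, card_erase_of_mem h]
  · rw [(disjoint_singleton_right.2 h).symmDiff_eq_sup, sup_eq_union,
      card_union_of_disjoint (disjoint_singleton_right.2 h), card_singleton]

/-- The naive exponents in the convolution add up to at least `|M| - 1`. The symmetry
`fourier_symmDiff_max`, applied to the factor whose index misses `max M`, adds one. -/
theorem FourierDvd.fourier_mul_mem (ha : a ∈ A) (hr : r ∈ A) (h2 : 2 * r = 1)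
    (hG : FourierDvd A a M Nat.pred G) (hH : FourierDvd A a M id H)
    (hG0 : ∀ Y ⊆ M, ¬ Even Y.card → G Y = 0) (hH0 : ∀ Y ⊆ M, ¬ Even Y.card → H Y = 0) :
    fourier M (fun Y => G Y * H Y) M ∈ powMod A a M.card := by
  refine mem_of_two_pow_mul hr h2 (m := M.card) ?_
  rw [← fourier_mul]
  refine Submodule.sum_mem _ fun I hI => ?_
  have hI := mem_powerset.1 hI
  have hc : (symmDiff M I).card + I.card = M.card := by
    have h : symmDiff M I = M \ I := symmDiff_of_ge hI
    rw [h, card_sdiff_add_card_eq_card hI]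
  rcases M.eq_empty_or_nonempty with rfl | h
  · obtain rfl := subset_empty.1 hI
    have h1 := mul_mem_powMod (hG ∅ hI) (hH _ (symmDiff_subset (empty_subset _) hI))
    exact powMod_anti ha (Nat.zero_le _) h1
  have hm : ∀ y ∈ M, y ≤ M.max' h := fun y hy => M.le_max' y hy
  have hmM : {M.max' h} ⊆ M := singleton_subset_iff.2 (M.max'_mem h)
  by_cases hmI : M.max' h ∈ I
  -- Here `M \ I` misses the maximum: enlarging it raises the exponent for `H`.
  · rw [← fourier_symmDiff_max hm hH0]
    have h1 := mul_mem_powMod (hG I hI)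
      (hH _ (symmDiff_subset (symmDiff_subset Subset.rfl hI) hmM))
    rw [id, card_symmDiff_singleton, if_neg] at h1
    · refine powMod_anti ha ?_ h1
      have := card_pos.2 ⟨_, hmI⟩
      simp only [Nat.pred_eq_sub_one]
      omega
    · simp [mem_symmDiff, hmI, M.max'_mem h]
  -- Here `I` misses the maximum: enlarging it makes up for the predecessor in the exponent for `G`.
  · rw [← fourier_symmDiff_max hm hG0]
    have h1 := mul_mem_powMod (hG _ (symmDiff_subset hI hmM))
      (hH _ (symmDiff_subset Subset.rfl hI))
    rw [id, card_symmDiff_singleton, if_neg hmI] at h1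
    refine powMod_anti ha ?_ h1
    simp only [Nat.pred_eq_sub_one]
    omega

theorem even_part_eq (h2 : 2 * r = 1) {m : Fin n} (hm : ∀ y ∈ M, y ≤ m) {Y : Finset (Fin n)}
    (hY : Y ⊆ M) :
    r * (G Y + chi Q {m} Y * G Y) = if Even Y.card then G Y else 0 := by
  rw [chi_singleton_max hm hY]
  split_ifs with h
  · rw [h.neg_one_pow]; linear_combination G Y * h2
  · rw [(Nat.not_even_iff_odd.1 h).neg_one_pow]; ring

/-- Taking the even part averages the coefficients at `I` and at `symmDiff I {max M}`, and the
second index has at least `|I| - 1` elements. -/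
theorem FourierDvd.even_part (ha : a ∈ A) (hr : r ∈ A) (h2 : 2 * r = 1)
    (hG : FourierDvd A a M id G) :
    FourierDvd A a M Nat.pred fun Y => if Even Y.card then G Y else 0 := by
  intro I hI
  rcases M.eq_empty_or_nonempty with rfl | h
  · obtain rfl := subset_empty.1 hI
    rw [fourier_congr (H := G)]
    · exact powMod_anti ha (Nat.pred_le _) (hG _ hI)
    · intro Y hY
      simp [subset_empty.1 hY]
  have hm : ∀ y ∈ M, y ≤ M.max' h := fun y hy => M.le_max' y hy
  have hmM : {M.max' h} ⊆ M := singleton_subset_iff.2 (M.max'_mem h)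
  rw [← fourier_congr (fun Y hY => even_part_eq h2 hm hY), fourier_const_mul, fourier_add,
    fourier_chi_mul]
  refine mul_mem_powMod_left hr (Submodule.add_mem _ ?_ ?_)
  · exact powMod_anti ha (Nat.pred_le _) (hG I hI)
  · refine powMod_anti ha ?_ (hG _ (symmDiff_subset hI hmM))
    rw [id, card_symmDiff_singleton, Nat.pred_eq_sub_one]
    split_ifs <;> omega

/-- The projector to even subsets is half of `1 + chi {max M}`. The factor `a` pays for the
one-element character, so `a` times the projector satisfies the condition and multiplicativity
applies. -/
theorem FourierDvd.mul_even_part (ha : a ∈ A) (hr : r ∈ A) (h2 : 2 * r = 1)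
    (hG : FourierDvd A a M id G) :
    FourierDvd A a M id fun Y => a * if Even Y.card then G Y else 0 := by
  rcases M.eq_empty_or_nonempty with rfl | h
  · refine ((fourierDvd_const ha).mul ha hr h2 hG).congr fun Y hY => ?_
    simp [subset_empty.1 hY]
  have hm : ∀ y ∈ M, y ≤ M.max' h := fun y hy => M.le_max' y hy
  have hmM : {M.max' h} ⊆ M := singleton_subset_iff.2 (M.max'_mem h)
  have h1 : r * a ∈ powMod A a ({M.max' h} : Finset (Fin n)).card := by
    rw [card_singleton]
    simpa using mul_mem_powMod_left hr (pow_mem_powMod (A := A) (a := a) 1)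
  refine (((fourierDvd_const (A.mul_mem hr ha)).add (fourierDvd_chi hmM h1)).mul ha hr h2
    hG).congr fun Y hY => ?_
  rw [← even_part_eq h2 hm hY]
  ring

end FourierDvd

/-! ### Divisibility by linear forms in `Sym V` -/

section Localizations

variable {k : Type*} [Field k] {V : Type*} [AddCommGroup V] [Module k V]

/-- In a basis containing a multiple of the dual partner's vector `v`, here `v` itself, `ι v`
becomes a variable of a polynomial ring. -/
theorem prime_ι {v : V} (hv : v ≠ 0) : Prime (ι k V v) := by
  obtain ⟨f, hf⟩ : ∃ f : Module.Dual k V, f v ≠ 0 := by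
    by_contra! hc
    exact hv ((Module.forall_dual_apply_eq_zero_iff k v).1 hc)
  obtain ⟨N, b, i, rfl, -⟩ := exists_basis_of_pairing_ne_zero hf
  rw [← MulEquiv.prime_iff (equivMvPolynomial b).toMulEquiv]
  change Prime (equivMvPolynomial b (ι k V (b i)))
  rw [equivMvPolynomial_ι_apply]
  exact MvPolynomial.X_prime

theorem not_ι_dvd_ι {u v : V} {f : Module.Dual k V} (hu : f u = 0) (hv : f v ≠ 0) :
    ¬ ι k V u ∣ ι k V v := by
  rintro ⟨c, hc⟩
  apply hv
  have := congrArg (SymmetricAlgebra.lift f) hc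
  rwa [map_mul, lift_ι_apply, lift_ι_apply, hu, zero_mul] at this

theorem homNonzero_le_nonZeroDivisors :
    homNonzero k V ≤ nonZeroDivisors (SymmetricAlgebra k V) :=
  fun _ hs => mem_nonZeroDivisors_of_ne_zero hs.1

instance : IsDomain (QRing k V) :=
  IsLocalization.isDomain_of_le_nonZeroDivisors _
    (homNonzero_le_nonZeroDivisors (k := k) (V := V))

theorem algebraMap_QRing_injective :
    Function.Injective (algebraMap (SymmetricAlgebra k V) (QRing k V)) :=
  IsLocalization.injective _ homNonzero_le_nonZeroDivisors

variable {σ : Submonoid (SymmetricAlgebra k V)}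

theorem algebraMap_mem_rRing (p : SymmetricAlgebra k V) :
    algebraMap _ (QRing k V) p ∈ rRing σ := ⟨1, σ.one_mem, p, by simp⟩

theorem vecQ_mem_rRing (v : V) : vecQ v ∈ rRing σ := algebraMap_mem_rRing _

theorem rRing_mono {τ : Submonoid (SymmetricAlgebra k V)} (h : σ ≤ τ) : rRing σ ≤ rRing τ :=
  fun _ ⟨s, hs, p, hx⟩ => ⟨s, h hs, p, hx⟩

/-- The inverse of `2` in `Q`. -/
def halfQ : QRing k V := algebraMap _ _ (algebraMap k (SymmetricAlgebra k V) 2⁻¹)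

theorem halfQ_mem : (halfQ : QRing k V) ∈ rRing σ := algebraMap_mem_rRing _

theorem two_mul_halfQ (h2 : (2 : k) ≠ 0) : 2 * (halfQ : QRing k V) = 1 := by
  have : (2 : QRing k V) = 
      algebraMap (SymmetricAlgebra k V) _ (algebraMap k _ 2) := by
    rw [map_ofNat, map_ofNat]
  rw [halfQ, this, ← map_mul, ← map_mul, mul_inv_cancel₀ h2, map_one, map_one]

/-- The multiplicative set of all elements not divisible by the nonzero vector `v`. -/
def notDvd (v : V) (hv : v ≠ 0) : Submonoid (SymmetricAlgebra k V) where
  carrier := {s | ¬ ι k V v ∣ s}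
  one_mem' := fun h => (prime_ι hv).not_isUnit (isUnit_of_dvd_one h)
  mul_mem' := fun ha hb h => ((prime_ι hv).dvd_or_dvd h).elim ha hb

theorem inverse_vecQ_mem {u v : V} {hv : v ≠ 0} (h : ¬ ι k V v ∣ ι k V u) :
    Ring.inverse (vecQ u) ∈ rRing (notDvd (k := k) v hv) := by
  have hu : u ≠ 0 := by
    rintro rfl
    simp at h
  exact ⟨ι k V u, h, 1, by rw [map_one]; exact Ring.mul_inverse_cancel _ (isUnit_vecQ hu)⟩

/-- Comparing the two fractions shows that the prime `v` divides `s' * p`. It does not divide `s'`,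
so it divides `p` and cancels. -/
theorem mem_rRing_of_vecQ_mul {v : V} (hv : v ≠ 0) {x : QRing k V}
    (h1 : vecQ v * x ∈ rRing σ) (h2 : x ∈ rRing (notDvd v hv)) : x ∈ rRing σ := by
  obtain ⟨s, hs, p, hx⟩ := h1
  obtain ⟨s', hs', p', hx'⟩ := h2
  have h : s' * p = s * (ι k V v * p') := by
    apply algebraMap_QRing_injective
    rw [map_mul, map_mul, map_mul, ← hx, ← hx', vecQ]
    ring
  have hdvd : ι k V v ∣ s' * p := h ▸ (dvd_mul_right _ _).mul_left _
  obtain ⟨q, rfl⟩ := ((prime_ι hv).dvd_or_dvd hdvd).resolve_left hs'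
  refine ⟨s, hs, q, (isUnit_vecQ hv).mul_left_cancel ?_⟩
  rw [map_mul] at hx
  rw [mul_left_comm, hx, vecQ]

theorem mem_powMod_rRing {v : V} (hv : v ≠ 0) {m : ℕ} {x : QRing k V} (h1 : x ∈ rRing σ)
    (h2 : x ∈ powMod (rRing (notDvd v hv)) (vecQ v) m) : x ∈ powMod (rRing σ) (vecQ v) m := by
  obtain ⟨y, hy, rfl⟩ := mem_powMod.1 h2
  refine mem_powMod.2 ⟨y, ?_, rfl⟩
  clear h2
  induction m with
  | zero => simpa using h1
  | succ m ih =>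
    refine ih (mem_rRing_of_vecQ_mul hv (by rwa [pow_succ', mul_assoc] at h1) ?_)
    exact (rRing _).mul_mem ((rRing _).pow_mem (vecQ_mem_rRing v) m) hy

theorem mem_rRing_of_prod_mul {ι' : Type*} (s : Finset ι') (u : ι' → V) (hu : ∀ i, u i ≠ 0)
    {x : QRing k V} (h1 : (∏ i ∈ s, vecQ (u i)) * x ∈ rRing σ)
    (h2 : ∀ i, x ∈ rRing (notDvd (u i) (hu i))) : x ∈ rRing σ := by
  classical
  induction s using Finset.induction_on with
  | empty => simpa using h1
  | insert i s hi ih =>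
    rw [Finset.prod_insert hi, mul_assoc] at h1
    refine ih (mem_rRing_of_vecQ_mul (hu i) h1 ((rRing _).mul_mem ?_ (h2 i)))
    exact (rRing _).prod_mem fun j _ => vecQ_mem_rRing _

end Localizations

/-! ### Homogeneous components -/

section Components

variable {k : Type*} [Field k] {V : Type*} [AddCommGroup V] [Module k V]

/-- The homomorphism `Sym V → Sym V [T, T⁻¹]` that multiplies vectors by `T ^ 2`. -/
def symDeg : SymmetricAlgebra k V →ₐ[k] LaurentPolynomial (SymmetricAlgebra k V) :=
  SymmetricAlgebra.lift
    ((AddMonoidAlgebra.lsingle (R := k) (2 : ℤ)) ∘ₗ ι k V)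

/-- The exponent of `T` records the degree, so homogeneous components can be read off as
coefficients of the image under a ring homomorphism. -/
theorem symDeg_of_mem {i : ℤ} {p : SymmetricAlgebra k V} (hp : p ∈ symGr k V i) :
    symDeg p = AddMonoidAlgebra.single i p := by
  have h : ∀ (d : ℕ) (q : SymmetricAlgebra k V), q ∈ LinearMap.range (ι k V) ^ d →
      symDeg q = AddMonoidAlgebra.single (2 * (d : ℤ)) q := by
    intro d q hq
    induction hq using Submodule.pow_induction_on_left' with
    | algebraMap r => simp [LaurentPolynomial.algebraMap_apply]
    | add x y i hx hy ihx ihy => rw [map_add, ihx, ihy, AddMonoidAlgebra.single_add]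
    | mem_mul m hm i x hx ih =>
      obtain ⟨v, rfl⟩ := hm
      rw [map_mul, ih]
      have : symDeg (ι k V v) = AddMonoidAlgebra.single 2 (ι k V v) := lift_ι_apply _ _
      rw [this, AddMonoidAlgebra.single_mul_single]
      congr 1
      push_cast
      omega
  unfold symGr at hp
  induction hp using Submodule.iSup_induction' with
  | mem d x hx =>
    induction hx using Submodule.iSup_induction' with
    | mem hd x hx => rw [h d x hx, hd]
    | zero => simp
    | add x y _ _ hx hy => rw [map_add, hx, hy, AddMonoidAlgebra.single_add]
  | zero => simp
  | add x y _ _ hx hy => rw [map_add, hx, hy, AddMonoidAlgebra.single_add]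

/-- The homomorphism `Sym V → Q[T, T⁻¹]` that multiplies vectors by `T ^ 2`. -/
def symDegQ : SymmetricAlgebra k V →+* LaurentPolynomial (QRing k V) :=
  (AddMonoidAlgebra.mapRingHom ℤ (algebraMap _ (QRing k V))).comp symDeg.toRingHom

theorem symDegQ_of_mem {i : ℤ} {p : SymmetricAlgebra k V} (hp : p ∈ symGr k V i) :
    symDegQ p = AddMonoidAlgebra.single i (algebraMap _ (QRing k V) p) := by
  change AddMonoidAlgebra.mapRingHom ℤ (algebraMap _ (QRing k V)) (symDeg p) = _
  rw [symDeg_of_mem hp, AddMonoidAlgebra.mapRingHom_single]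

/-- The homomorphism `Q → Q[T, T⁻¹]` that multiplies homogeneous elements of degree `i`
by `T ^ i`. -/
def qDeg : QRing k V →+* LaurentPolynomial (QRing k V) :=
  IsLocalization.lift (M := homNonzero k V) (g := symDegQ) fun s => by
    obtain ⟨s, hs, i, hi⟩ := s
    rw [symDegQ_of_mem hi, LaurentPolynomial.single_eq_C_mul_T]
    exact ((IsLocalization.map_units (QRing k V)
      (⟨s, hs, i, hi⟩ : homNonzero k V)).map LaurentPolynomial.C).mul (LaurentPolynomial.isUnit_T i)

theorem qDeg_algebraMap (p : SymmetricAlgebra k V) :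
    qDeg (algebraMap _ (QRing k V) p) = symDegQ p := IsLocalization.lift_eq _ _

/-- The homogeneous component of degree `i` of an element of `Q`. -/
def comp (i : ℤ) (x : QRing k V) : QRing k V := (qDeg x).coeff i

theorem comp_add (i : ℤ) (x y : QRing k V) : comp i (x + y) = comp i x + comp i y := by
  simp [comp]

theorem comp_zero (i : ℤ) : comp i (0 : QRing k V) = 0 := by simp [comp]

theorem comp_sum {ι' : Type*} (i : ℤ) (s : Finset ι') (x : ι' → QRing k V) :
    comp i (∑ j ∈ s, x j) = ∑ j ∈ s, comp i (x j) :=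
  map_sum (AddMonoidHom.mk' (comp i) (comp_add i)) x s

theorem comp_algebraMap_mul {b : ℤ} {s : SymmetricAlgebra k V} (hs : s ∈ symGr k V b) (i : ℤ)
    (x : QRing k V) :
    comp i (algebraMap _ _ s * x) = algebraMap _ _ s * comp (i - b) x := by
  rw [comp, map_mul, qDeg_algebraMap, symDegQ_of_mem hs, AddMonoidAlgebra.coeff_single_mul_apply,
    comp, neg_add_eq_sub]

theorem comp_neg_one_pow_mul (m : ℕ) (i : ℤ) (x : QRing k V) :
    comp i ((-1) ^ m * x) = (-1) ^ m * comp i x := by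
  rcases neg_one_pow_eq_or (QRing k V) m with h | h <;> simp [h, comp]

theorem comp_algebraMap_of_mem {i j : ℤ} {p : SymmetricAlgebra k V} (hp : p ∈ symGr k V i) :
    comp j (algebraMap _ (QRing k V) p) = if i = j then algebraMap _ _ p else 0 := by
  rw [comp, qDeg_algebraMap, symDegQ_of_mem hp, AddMonoidAlgebra.coeff_single, Finsupp.single_apply]

theorem exists_comp_algebraMap (i : ℤ) (p : SymmetricAlgebra k V) :
    ∃ q ∈ symGr k V i, comp i (algebraMap _ (QRing k V) p) = algebraMap _ _ q := by
  have hp : p ∈ ⨆ i : ℤ, symGr k V i := by rw [iSup_symGr]; trivial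
  induction hp using Submodule.iSup_induction' with
  | mem j p hp =>
    rw [comp_algebraMap_of_mem hp]
    split_ifs with h
    · exact ⟨p, h ▸ hp, rfl⟩
    · exact ⟨0, Submodule.zero_mem _, (map_zero _).symm⟩
  | zero => exact ⟨0, Submodule.zero_mem _, by rw [map_zero, comp_zero]⟩
  | add p q _ _ ihp ihq =>
    obtain ⟨p', hp', hp⟩ := ihp
    obtain ⟨q', hq', hq⟩ := ihq
    exact ⟨p' + q', Submodule.add_mem _ hp' hq', by rw [map_add, map_add, comp_add, hp, hq]⟩

/-- Allowing every larger `S'` makes it possible to use one finite set of degrees for several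
elements. -/
theorem exists_sum_comp_algebraMap (p : SymmetricAlgebra k V) :
    ∃ S : Finset ℤ, ∀ S', S ⊆ S' →
      ∑ i ∈ S', comp i (algebraMap _ (QRing k V) p) = algebraMap _ _ p := by
  classical
  have hp : p ∈ ⨆ i : ℤ, symGr k V i := by rw [iSup_symGr]; trivial
  induction hp using Submodule.iSup_induction' with
  | mem j p hp =>
    refine ⟨{j}, fun S' hS => ?_⟩
    simp only [comp_algebraMap_of_mem hp]
    rw [Finset.sum_ite_eq, if_pos (Finset.singleton_subset_iff.1 hS)]
  | zero => exact ⟨∅, fun S' _ => by simp [comp_zero]⟩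
  | add p q _ _ ihp ihq =>
    obtain ⟨S, hS⟩ := ihp
    obtain ⟨S₁, hS₁⟩ := ihq
    refine ⟨S ∪ S₁, fun S' h => ?_⟩
    simp only [map_add, comp_add, Finset.sum_add_distrib]
    rw [hS S' (Finset.union_subset_left h), hS₁ S' (Finset.union_subset_right h)]

theorem exists_fraction (x : QRing k V) : ∃ (b : ℤ) (s p : SymmetricAlgebra k V),
    s ∈ symGr k V b ∧ s ≠ 0 ∧ algebraMap _ (QRing k V) s * x = algebraMap _ _ p := by
  obtain ⟨⟨p, s, hs, b, hb⟩, h⟩ := IsLocalization.surj (homNonzero k V) x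
  exact ⟨b, s, p, hb, hs, by rw [mul_comm]; exact h⟩

theorem comp_mem_qGr (i : ℤ) (x : QRing k V) : comp i x ∈ qGr k V i := by
  obtain ⟨b, s, p, hs, hs0, h⟩ := exists_fraction x
  obtain ⟨q, hq, hq'⟩ := exists_comp_algebraMap (i + b) p
  refine ⟨i + b, b, q, s, hq, hs, hs0, by ring, ?_⟩
  rw [← hq', ← h, comp_algebraMap_mul hs, add_sub_cancel_right]

theorem comp_mem_rRing {σ : Submonoid (SymmetricAlgebra k V)}
    (hσ : ∀ s ∈ σ, ∃ i, s ∈ symGr k V i) (i : ℤ) {x : QRing k V} (hx : x ∈ rRing σ) :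
    comp i x ∈ rRing σ := by
  obtain ⟨s, hs, p, h⟩ := hx
  obtain ⟨b, hb⟩ := hσ s hs
  obtain ⟨q, hq, hq'⟩ := exists_comp_algebraMap (i + b) p
  refine ⟨s, hs, q, ?_⟩
  rw [← hq', ← h, comp_algebraMap_mul hb, add_sub_cancel_right]

theorem isUnit_algebraMap {b : ℤ} {s : SymmetricAlgebra k V} (hs : s ∈ symGr k V b)
    (hs0 : s ≠ 0) : IsUnit (algebraMap _ (QRing k V) s) :=
  IsLocalization.map_units (QRing k V) (⟨s, hs0, b, hs⟩ : homNonzero k V)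

theorem exists_sum_comp (x : QRing k V) :
    ∃ S : Finset ℤ, ∀ S', S ⊆ S' → ∑ i ∈ S', comp i x = x := by
  obtain ⟨b, s, p, hs, hs0, h⟩ := exists_fraction x
  obtain ⟨S, hS⟩ := exists_sum_comp_algebraMap p
  -- Clearing the denominator `s` of degree `b` raises all degrees by `b`.
  refine ⟨S.map (Equiv.subRight b).toEmbedding, fun S' hS' => ?_⟩
  refine (isUnit_algebraMap hs hs0).mul_left_cancel ?_
  have h1 := hS (S'.map (Equiv.addRight b).toEmbedding) fun i hi =>
    Finset.mem_map.2 ⟨i - b, hS' (Finset.mem_map.2 ⟨i, hi, rfl⟩), by simp⟩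
  rw [h, ← h1, Finset.sum_map, Finset.mul_sum]
  refine Finset.sum_congr rfl fun i _ => ?_
  rw [← h, comp_algebraMap_mul hs]
  simp

theorem algebraMap_mem_qGr {b : ℤ} {s : SymmetricAlgebra k V} (hs : s ∈ symGr k V b) :
    algebraMap _ (QRing k V) s ∈ qGr k V b :=
  ⟨b, 0, s, 1, hs, one_mem_symGr, one_ne_zero, by simp, by simp⟩

theorem mul_mem_qGr {i j : ℤ} {x y : QRing k V} (hx : x ∈ qGr k V i) (hy : y ∈ qGr k V j) :
    x * y ∈ qGr k V (i + j) := by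
  obtain ⟨a, b, p, s, hp, hs, hs0, hab, hx⟩ := hx
  obtain ⟨a', b', p', s', hp', hs', hs0', hab', hy⟩ := hy
  refine ⟨a + a', b + b', p * p', s * s', mul_mem_symGr hp hp', mul_mem_symGr hs hs',
    mul_ne_zero hs0 hs0', by omega, ?_⟩
  rw [map_mul, map_mul, ← hx, ← hy]
  ring

theorem mem_qGr_of_algebraMap_mul {i b : ℤ} {s : SymmetricAlgebra k V} (hs : s ∈ symGr k V b)
    (hs0 : s ≠ 0) {x : QRing k V} (h : algebraMap _ _ s * x ∈ qGr k V i) : x ∈ qGr k V (i - b) := by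
  obtain ⟨a, c, p, s', hp, hs', hs0', hab, hx⟩ := h
  refine ⟨a, c + b, p, s' * s, hp, mul_mem_symGr hs' hs, mul_ne_zero hs0' hs0, by omega, ?_⟩
  rw [← hx, map_mul, mul_assoc]

theorem inverse_mem_qGr {b : ℤ} {s : SymmetricAlgebra k V} (hs : s ∈ symGr k V b)
    (hs0 : s ≠ 0) : Ring.inverse (algebraMap _ (QRing k V) s) ∈ qGr k V (-b) := by
  rw [← zero_sub]
  refine mem_qGr_of_algebraMap_mul hs hs0 ?_
  rw [Ring.mul_inverse_cancel _ (isUnit_algebraMap hs hs0), 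
    ← map_one (algebraMap (SymmetricAlgebra k V) _)]
  exact algebraMap_mem_qGr one_mem_symGr

theorem prod_ι_mem_symGr {ι' : Type*} (s : Finset ι') (u : ι' → V) :
    ∏ i ∈ s, ι k V (u i) ∈ symGr k V (2 * s.card) := by
  classical
  induction s using Finset.induction_on with
  | empty => simpa using one_mem_symGr (k := k) (V := V)
  | insert i s hi ih =>
    rw [Finset.prod_insert hi, Finset.card_insert_of_notMem hi]
    have h : 2 * ((s.card + 1 : ℕ) : ℤ) = 2 + 2 * s.card := by
      push_cast
      ring
    rw [h]
    exact mul_mem_symGr (ι_mem_symGr (k := k) (u i)) ih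

theorem comp_mem_powMod {σ : Submonoid (SymmetricAlgebra k V)}
    (hσ : ∀ s ∈ σ, ∃ i, s ∈ symGr k V i) (i : ℤ) {v : V} {m : ℕ} {x : QRing k V}
    (hx : x ∈ powMod (rRing σ) (vecQ v) m) : comp i x ∈ powMod (rRing σ) (vecQ v) m := by
  obtain ⟨y, hy, rfl⟩ := mem_powMod.1 hx
  have h : ι k V v ^ m ∈ symGr k V (2 * m) := by
    simpa using prod_ι_mem_symGr (k := k) (Finset.range m) fun _ => v
  have h1 := comp_algebraMap_mul h i y
  rw [map_pow] at h1
  exact mem_powMod.2 ⟨_, comp_mem_rRing hσ _ hy, h1⟩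

end Components

/-! ### Roots -/

section Roots

variable {k : Type*} [Field k] {V : Type*} [AddCommGroup V] [Module k V] {W : Type*} [Group W]
  {ρ : Representation k W V} {t : W} {a b : V}

theorem IsRoot.ne_zero (h2 : (2 : k) ≠ 0) (ha : IsRoot ρ t a) : a ≠ 0 := by
  rintro rfl
  obtain ⟨f, hf, -⟩ := ha
  exact h2 (by rw [← hf, map_zero])

theorem IsRoot.act_self (ha : IsRoot ρ t a) : ρ t a = -a := by
  obtain ⟨f, hf, h⟩ := ha
  rw [h, hf, two_smul]
  abel

/-- Comparing `t a = -a` with `t a = a - f(a) b` gives `2a = f(a) b`. -/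
theorem IsRoot.exists_smul (h2 : (2 : k) ≠ 0) (ha : IsRoot ρ t a) (hb : IsRoot ρ t b) :
    ∃ c : k, c ≠ 0 ∧ a = c • b := by
  have h1 := ha.act_self
  have ha0 := ha.ne_zero h2
  obtain ⟨f, hf, h⟩ := hb
  rw [h, sub_eq_iff_eq_add] at h1
  have h3 : a = (2⁻¹ * f a) • b := by
    rw [mul_smul, eq_inv_smul_iff₀ h2, two_smul]
    nth_rewrite 1 [h1]
    abel
  refine ⟨_, fun h0 => ha0 ?_, h3⟩
  rw [h3, h0, zero_smul]

theorem IsRoot.conj (ha : IsRoot ρ t a) (w : W) : IsRoot ρ (w * t * w⁻¹) (ρ w a) := by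
  obtain ⟨f, hfa, hf⟩ := ha
  refine ⟨f ∘ₗ ρ w⁻¹, ?_, fun v => ?_⟩
  · simp [← Module.End.mul_apply, ← map_mul, hfa]
  · have : ρ w (ρ w⁻¹ v) = v := by simp [← Module.End.mul_apply, ← map_mul]
    simp [hf, this]

theorem IsRoot.not_ι_dvd (h2 : (2 : k) ≠ 0) (ha : IsRoot ρ t a) (hb : b ≠ 0)
    (h : ∀ c : k, c ≠ 0 → b ≠ c • a) : ¬ ι k V a ∣ ι k V b := by
  obtain ⟨f, hf, -⟩ := ha
  -- This vector is the projection of `b` to the kernel of the coroot along `a`.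
  have hu : b - (2⁻¹ * f b) • a ≠ 0 := by
    intro h0
    rw [sub_eq_zero] at h0
    refine h _ (fun hc => hb ?_) h0
    rw [h0, hc, zero_smul]
  obtain ⟨φ, hφ⟩ : ∃ φ : Module.Dual k V, φ (b - (2⁻¹ * f b) • a) ≠ 0 := by
    by_contra! hc
    exact hu ((Module.forall_dual_apply_eq_zero_iff k _).1 hc)
  -- This functional kills `a`, and its value on `b` is that of `φ` on the projection.
  refine not_ι_dvd_ι (f := φ - (2⁻¹ * φ a) • f) ?_ ?_
  · simp only [LinearMap.sub_apply, LinearMap.smul_apply, hf, smul_eq_mul]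
    field_simp
    ring
  · simp only [map_sub, map_smul, smul_eq_mul] at hφ
    simp only [LinearMap.sub_apply, LinearMap.smul_apply, smul_eq_mul]
    convert! hφ using 1
    ring

theorem vecQ_smul (c : k) (v : V) :
    vecQ (c • v) = algebraMap (SymmetricAlgebra k V) (QRing k V) (algebraMap k _ c) * vecQ v := by
  rw [vecQ, map_smul, Algebra.smul_def, map_mul, vecQ]

theorem vecQ_sub (u v : V) : (vecQ (u - v) : QRing k V) = vecQ u - vecQ v := by
  rw [vecQ, map_sub, map_sub, vecQ, vecQ]

end Roots

/-! ### Combinatorics of subexpressions -/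

section Flips

variable {W : Type*} [Group W] {B : Type*} {C : CoxeterMatrix B} {cs : CoxeterSystem C W}
  {n : ℕ} (t : Fin n → Refl cs)

theorem flip_empty (ε : Fin n → Bool) : flip ∅ ε = ε := by
  funext i
  simp [flip]

theorem flip_flip (Y Z : Finset (Fin n)) (ε : Fin n → Bool) :
    flip Y (flip Z ε) = flip (symmDiff Y Z) ε := by
  funext i
  simp only [flip, mem_symmDiff]
  by_cases hY : i ∈ Y <;> by_cases hZ : i ∈ Z <;> simp [hY, hZ]

/-- The set of positions at which two subexpressions differ. -/
def diffSet (ε ε' : Fin n → Bool) : Finset (Fin n) := univ.filter fun i => ε i ≠ ε' i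

theorem flip_diffSet (ε ε' : Fin n → Bool) : flip (diffSet ε ε') ε = ε' := by
  funext i
  simp only [flip, diffSet, mem_filter, mem_univ, true_and]
  cases ε i <;> cases ε' i <;> simp

theorem diffSet_flip (Y : Finset (Fin n)) (ε : Fin n → Bool) : diffSet ε (flip Y ε) = Y := by
  ext i
  rw [diffSet, mem_filter, flip]
  by_cases h : i ∈ Y <;> simp [h]

/-- The product of the first `m` factors of a subexpression. -/
def pre (ε : Fin n → Bool) (m : ℕ) : W := ((powers t ε).take m).prod

theorem target_eq_pre (ε : Fin n → Bool) : target t ε = pre t ε n := by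
  rw [target, pre, List.take_of_length_le]
  simp [powers]

theorem pre_succ (ε : Fin n → Bool) (i : Fin n) :
    pre t ε (i + 1) = pre t ε i * if ε i then (t i).1 else 1 := by
  rw [pre, pre, List.prod_take_succ _ _ (by simp [powers])]
  simp [powers]

/-- The reflection `ε^{<i} t_i (ε^{<i})⁻¹`. -/
def reflAt (ε : Fin n → Bool) (i : Fin n) : Refl cs :=
  ⟨before t ε i * (t i).1 * (before t ε i)⁻¹, (t i).2.conj _⟩

open Classical in
/-- The set `M_p(ε)` as a finite set. -/
def posFinset (ε : Fin n → Bool) (p : Refl cs) : Finset (Fin n) :=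
  univ.filter fun i => reflAt t ε i = p

theorem mem_posFinset {ε : Fin n → Bool} {p : Refl cs} {i : Fin n} :
    i ∈ posFinset t ε p ↔ reflAt t ε i = p := by simp [posFinset]

theorem subset_positions {ε : Fin n → Bool} {p : Refl cs} {X : Finset (Fin n)} :
    (X : Set (Fin n)) ⊆ positions t ε p ↔ X ⊆ posFinset t ε p := by
  refine forall₂_congr fun i _ => ?_
  rw [mem_posFinset, Subtype.ext_iff]
  rfl

variable {t}

/-- At a position of `M_p(ε)` one has `ε^{<i} t_i = p ε^{<i}`. Since `p` and `t_i` are involutions,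
inserting or deleting `t_i` there multiplies all later partial products by `p` on the left. -/
theorem pre_flip {ε : Fin n → Bool} {p : Refl cs} {Y : Finset (Fin n)}
    (hY : Y ⊆ posFinset t ε p) (m : ℕ) (hm : m ≤ n) :
    pre t (flip Y ε) m = p.1 ^ (Y.filter fun y => y.1 < m).card * pre t ε m := by
  induction m with
  | zero => simp [pre]
  | succ m ih =>
    have ih := ih (by omega)
    let i : Fin n := ⟨m, by omega⟩
    have h1 : pre t (flip Y ε) (m + 1) = pre t (flip Y ε) m * if flip Y ε i then (t i).1 else 1 :=
      pre_succ t _ i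
    have h2 : pre t ε (m + 1) = pre t ε m * if ε i then (t i).1 else 1 := pre_succ t _ i
    have h3 : (t i).1 * (t i).1 = 1 := (t i).2.mul_self
    by_cases hi : i ∈ Y
    · have h4 : (Y.filter fun y => y.1 < m + 1) = insert i (Y.filter fun y => y.1 < m) := by
        ext y
        simp only [mem_filter, mem_insert, Fin.ext_iff, i]
        constructor
        · rintro ⟨h, h'⟩
          by_cases h5 : y.1 = m
          · exact Or.inl h5
          · exact Or.inr ⟨h, by omega⟩
        · rintro (h | ⟨h, h'⟩)
          · have : y = i := Fin.ext h
            exact ⟨this ▸ hi, by omega⟩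
          · exact ⟨h, by omega⟩
      have h5 : i ∉ Y.filter fun y => y.1 < m := by simp [i]
      have h6 : pre t ε m * (t i).1 = p.1 * pre t ε m := by
        have := congrArg Subtype.val ((mem_posFinset t).1 (hY hi))
        change pre t ε m * (t i).1 * (pre t ε m)⁻¹ = p.1 at this
        rw [← this, inv_mul_cancel_right]
      have h7 : flip Y ε i = !(ε i) := by simp [flip, hi]
      rw [h1, h2, h4, card_insert_of_notMem h5, ih, h7, pow_succ]
      cases ε i
      · simp [mul_assoc, h6]
      · simp only [Bool.not_true, Bool.false_eq_true, if_false, if_true, mul_one]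
        rw [mul_assoc, h6, ← mul_assoc p.1, p.2.mul_self, one_mul]
    · have h4 : (Y.filter fun y => y.1 < m + 1) = Y.filter fun y => y.1 < m := by
        refine filter_congr fun y hy => ?_
        have : y.1 ≠ m := fun h => hi ((Fin.ext h : y = i) ▸ hy)
        omega
      have h7 : flip Y ε i = ε i := by simp [flip, hi]
      rw [h1, h2, h4, ih, h7, mul_assoc]

theorem before_flip {ε : Fin n → Bool} {p : Refl cs} {Y : Finset (Fin n)}
    (hY : Y ⊆ posFinset t ε p) (i : Fin n) :
    before t (flip Y ε) i = p.1 ^ (Y.filter (· < i)).card * before t ε i :=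
  pre_flip hY i.1 i.2.le

theorem target_flip {ε : Fin n → Bool} {p : Refl cs} {Y : Finset (Fin n)}
    (hY : Y ⊆ posFinset t ε p) : target t (flip Y ε) = p.1 ^ Y.card * target t ε := by
  rw [target_eq_pre, target_eq_pre, pre_flip hY n le_rfl]
  simp

/-- The flips conjugate the reflection at `i` by a power of `p`, which commutes with `p`. Hence
`M_p` is constant on a cube. -/
theorem reflAt_flip_eq_iff {ε : Fin n → Bool} {p : Refl cs} {Y : Finset (Fin n)}
    (hY : Y ⊆ posFinset t ε p) (i : Fin n) : reflAt t (flip Y ε) i = p ↔ reflAt t ε i = p := by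
  rw [Subtype.ext_iff, Subtype.ext_iff]
  change before t (flip Y ε) i * (t i).1 * (before t (flip Y ε) i)⁻¹ = p.1 ↔
    before t ε i * (t i).1 * (before t ε i)⁻¹ = p.1
  rw [before_flip hY]
  set m := (Y.filter (· < i)).card
  have h : Commute (p.1 ^ m) p.1 := (Commute.refl p.1).pow_left m
  have h1 : p.1 ^ m * before t ε i * (t i).1 * (p.1 ^ m * before t ε i)⁻¹ =
    p.1 ^ m * (before t ε i * (t i).1 * (before t ε i)⁻¹) * (p.1 ^ m)⁻¹ := by group
  simp only [h1]
  constructor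
  · intro h2
    rw [mul_inv_eq_iff_eq_mul, ← h.eq] at h2
    exact mul_left_cancel h2
  · intro h2
    rw [h2, h.eq, mul_inv_cancel_right]

theorem posFinset_flip {ε : Fin n → Bool} {p : Refl cs} {Y : Finset (Fin n)}
    (hY : Y ⊆ posFinset t ε p) : posFinset t (flip Y ε) p = posFinset t ε p := by
  ext i
  rw [mem_posFinset, mem_posFinset, reflAt_flip_eq_iff hY]

/-- Here `p` is an involution, and it is not `1` because its length is odd. -/
theorem even_card_of_target_flip {ε : Fin n → Bool} {p : Refl cs} {Y : Finset (Fin n)}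
    (hY : Y ⊆ posFinset t ε p) : target t (flip Y ε) = target t ε ↔ Even Y.card := by
  rw [target_flip hY, mul_eq_right]
  constructor
  · intro h
    by_contra ho
    obtain ⟨m, hm⟩ := Nat.not_even_iff_odd.1 ho
    rw [hm, pow_succ, pow_mul, pow_two, p.2.mul_self, one_pow, one_mul] at h
    have := p.2.odd_length
    rw [h, cs.length_one] at this
    exact absurd this (by decide)
  · rintro ⟨m, hm⟩
    rw [hm, ← two_mul, pow_mul, pow_two, p.2.mul_self, one_pow]

theorem extendZero_flip_of_not_even {A : Type*} [Zero A] {w : W} (g : SubTo t w → A)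
    {ε : Fin n → Bool} (hε : target t ε = w) {p : Refl cs} {Y : Finset (Fin n)}
    (hY : Y ⊆ posFinset t ε p) (h : ¬ Even Y.card) : extendZero t g (flip Y ε) = 0 := by
  rw [extendZero, dif_neg]
  rw [← hε, even_card_of_target_flip hY]
  exact h

theorem extendZero_coe {A : Type*} [Zero A] {w : W} (g : SubTo t w → A)
    (ε : SubTo t w) : extendZero t g ε.1 = g ε := by
  rw [extendZero, dif_pos ε.2]

end Flips

/-! ### The modules in terms of Fourier coefficients -/

section InX

variable {k : Type*} [Field k] {V : Type*} [AddCommGroup V] [Module k V]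
  {W : Type*} [Group W] {B : Type*} {C : CoxeterMatrix B} {cs : CoxeterSystem C W} {n : ℕ}
  {α : Refl cs → V} {σ : Submonoid (SymmetricAlgebra k V)} {t : Fin n → Refl cs} {w : W}
  {e : ℕ → ℕ}

/-- All `R`-valued functions on subexpressions whose alternating sums over `X ⊆ M_p(ε)` are
divisible by `α_p ^ e |X|`. -/
def InX (α : Refl cs → V) (σ : Submonoid (SymmetricAlgebra k V)) (t : Fin n → Refl cs)
    (e : ℕ → ℕ) (g : (Fin n → Bool) → QRing k V) : Prop :=
  (∀ ε, g ε ∈ rRing σ) ∧ ∀ (ε : Fin n → Bool) (p : Refl cs), ∀ X ⊆ posFinset t ε p,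
    sigmaAll X ε g ∈ powMod (rRing σ) (vecQ (α p)) (e X.card)

theorem mem_XAll {g : (Fin n → Bool) → QRing k V} : g ∈ XAll α σ t ↔ InX α σ t id g := by
  refine and_congr_right fun _ => forall₃_congr fun ε p X => ?_
  rw [subset_positions]
  rfl

theorem sigmaAll_flip (X Z : Finset (Fin n)) (ε : Fin n → Bool)
    (g : (Fin n → Bool) → QRing k V) :
    sigmaAll X (flip Z ε) g = ∑ Y ∈ X.powerset, chi _ X Y * g (flip (symmDiff Y Z) ε) := by
  simp only [sigmaAll, flip_flip]
  rfl

theorem sigmaAll_rebase {X Z : Finset (Fin n)} (hZ : Z ⊆ X) (ε : Fin n → Bool)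
    (g : (Fin n → Bool) → QRing k V) :
    sigmaAll X ε g = chi _ X Z * sigmaAll X (flip Z ε) g := by
  rw [sigmaAll_flip, sigmaAll, ← sum_powerset_symmDiff hZ, mul_sum]
  refine sum_congr rfl fun Y _ => ?_
  change chi _ X (symmDiff Y Z) * _ = _
  rw [chi_symmDiff_right]
  ring

/-- Odd flips leave `Sub(t, w)`, where the extension by zero vanishes. -/
theorem sigmaEven_eq_sigmaAll (g : SubTo t w → QRing k V) {ε : Fin n → Bool}
    (hε : target t ε = w) {p : Refl cs} {X : Finset (Fin n)} (hX : X ⊆ posFinset t ε p) :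
    sigmaEven X ε (extendZero t g) = sigmaAll X ε (extendZero t g) := by
  rw [sigmaEven, sigmaAll, sum_filter]
  refine sum_congr rfl fun Y hY => ?_
  split_ifs with h
  · rfl
  · rw [extendZero_flip_of_not_even g hε ((mem_powerset.1 hY).trans hX) h, mul_zero]

theorem extendZero_mem {g : SubTo t w → QRing k V} (hg : ∀ ε, g ε ∈ rRing σ)
    (ε : Fin n → Bool) : extendZero t g ε ∈ rRing σ := by
  unfold extendZero
  split_ifs
  · exact hg _
  · exact (rRing σ).zero_mem

/-- Base points outside `Sub(t, w)` impose nothing new: if the `X`-cube meets `Sub(t, w)`, rebasing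
it there costs only a sign; otherwise the sum is zero. -/
theorem inX_extendZero_iff {g : SubTo t w → QRing k V} :
    InX α σ t e (extendZero t g) ↔ (∀ ε, g ε ∈ rRing σ) ∧
      ∀ (ε : SubTo t w) (p : Refl cs), ∀ X ⊆ posFinset t ε.1 p,
        sigmaAll X ε.1 (extendZero t g) ∈ powMod (rRing σ) (vecQ (α p)) (e X.card) := by
  constructor
  · rintro ⟨h1, h2⟩
    exact ⟨fun ε => extendZero_coe g ε ▸ h1 ε.1, fun ε => h2 ε.1⟩
  · rintro ⟨h1, h2⟩
    refine ⟨extendZero_mem h1, fun ε p X hX => ?_⟩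
    by_cases h : ∃ Z ⊆ X, target t (flip Z ε) = w
    · obtain ⟨Z, hZ, hw⟩ := h
      rw [sigmaAll_rebase hZ]
      refine mul_mem_powMod_left (chi_mem _ _ _) (h2 ⟨_, hw⟩ p X ?_)
      rwa [posFinset_flip (hZ.trans hX)]
    · rw [sigmaAll, sum_eq_zero]
      · exact Submodule.zero_mem _
      · intro Y hY
        rw [extendZero, dif_neg, mul_zero]
        exact fun hw => h ⟨Y, mem_powerset.1 hY, hw⟩

theorem mem_XUpper {g : SubTo t w → QRing k V} :
    g ∈ XUpper α σ t w ↔ InX α σ t id (extendZero t g) := by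
  rw [inX_extendZero_iff]
  refine and_congr_right fun _ => forall₃_congr fun ε p X => ?_
  rw [subset_positions]
  refine forall_congr' fun hX => ?_
  rw [sigmaEven_eq_sigmaAll g ε.2 hX]
  rfl

/-- As `Nat.pred 0 = 0`, the condition for `X = ∅` only says that values lie in `R`, so the
restriction to nonempty `X` can be dropped. -/
theorem mem_XLower {g : SubTo t w → QRing k V} :
    g ∈ XLower α σ t w ↔ InX α σ t Nat.pred (extendZero t g) := by
  rw [inX_extendZero_iff]
  refine and_congr_right fun hg => forall₃_congr fun ε p X => ?_
  rw [subset_positions]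
  constructor
  · intro h hX
    rcases X.eq_empty_or_nonempty with rfl | h0
    · rw [card_empty]
      refine powMod_zero.2 ((rRing σ).sum_mem fun Y _ => ?_)
      exact (rRing σ).mul_mem (chi_mem _ ∅ _) (extendZero_mem hg _)
    · rw [← sigmaEven_eq_sigmaAll g ε.2 hX]
      exact h h0 hX
  · intro h _ hX
    rw [sigmaEven_eq_sigmaAll g ε.2 hX]
    exact h hX

/-- The subring of `Q` of all fractions with denominators not divisible by `α_p`. -/
abbrev locR (hα0 : ∀ p, α p ≠ 0) (p : Refl cs) : Subring (QRing k V) :=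
  rRing (notDvd (α p) (hα0 p))

theorem powMod_mono {Q : Type*} [CommRing Q] {A A' : Subring Q} (h : A ≤ A') {a x : Q} {m : ℕ}
    (hx : x ∈ powMod A a m) : x ∈ powMod A' a m := by
  obtain ⟨y, hy, rfl⟩ := mem_powMod.1 hx
  exact mem_powMod.2 ⟨y, h hy, rfl⟩

theorem InX.fourierDvd (h2 : (2 : k) ≠ 0) {hα0 : ∀ p, α p ≠ 0}
    (hσ : ∀ p, σ ≤ notDvd (α p) (hα0 p)) {g : (Fin n → Bool) → QRing k V}
    (hg : InX α σ t e g) (ε : Fin n → Bool) (p : Refl cs) :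
    FourierDvd (locR hα0 p) (vecQ (α p)) (posFinset t ε p) e fun Y => g (flip Y ε) := by
  refine fourierDvd_of_sum_mem halfQ_mem (two_mul_halfQ h2) fun X hX Z hZ => ?_
  rw [← sigmaAll_flip]
  exact powMod_mono (rRing_mono (hσ p)) (hg.2 (flip Z ε) p X (by rwa [posFinset_flip hZ]))

theorem FourierDvd.sigmaAll_mem (h2 : (2 : k) ≠ 0) {hα0 : ∀ p, α p ≠ 0} (he : Monotone e)
    {g : (Fin n → Bool) → QRing k V} (hg : ∀ ε, g ε ∈ rRing σ) {ε : Fin n → Bool} {p : Refl cs}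
    (h : FourierDvd (locR hα0 p) (vecQ (α p)) (posFinset t ε p) e fun Y => g (flip Y ε))
    {X : Finset (Fin n)} (hX : X ⊆ posFinset t ε p) :
    sigmaAll X ε g ∈ powMod (rRing σ) (vecQ (α p)) (e X.card) := by
  have := h.sum_mem (vecQ_mem_rRing _) halfQ_mem (two_mul_halfQ h2) he hX (empty_subset _)
  refine mem_powMod_rRing (hα0 p) ((rRing σ).sum_mem fun Y _ => ?_) ?_
  · exact (rRing σ).mul_mem (chi_mem _ X _) (hg _)
  · rw [← flip_empty ε, sigmaAll_flip]
    exact this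

end InX

/-! ### The factorization of `o` on a class of subexpressions -/

section OFun

variable {k : Type*} [Field k] {V : Type*} [AddCommGroup V] [Module k V]
  {W : Type*} [Group W] {B : Type*} {C : CoxeterMatrix B} {cs : CoxeterSystem C W} {n : ℕ}

/-- The factor of `o(f_Y ε)` at position `i`, for `Y ⊆ M_p(ε)` with `m` elements before `i`. -/
def oFactor (ρ : Representation k W V) (α : Refl cs → V) (t : Fin n → Refl cs)
    (ε : Fin n → Bool) (p : Refl cs) (i : Fin n) (m : ℕ) : V :=
  ρ (p.1 ^ m * before t ε i) (α (t i))

/-- The product of the factors of `o(f_Y ε)` at the positions outside `M_p(ε)`. -/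
def oFunOff (ρ : Representation k W V) (α : Refl cs → V) (t : Fin n → Refl cs)
    (ε : Fin n → Bool) (p : Refl cs) (Y : Finset (Fin n)) : QRing k V :=
  ∏ i ∈ (posFinset t ε p)ᶜ, vecQ (oFactor ρ α t ε p i (Y.filter (· < i)).card)

/-- The inverse of `oFunOff`. -/
def oFunOffInv (ρ : Representation k W V) (α : Refl cs → V) (t : Fin n → Refl cs)
    (ε : Fin n → Bool) (p : Refl cs) (Y : Finset (Fin n)) : QRing k V :=
  ∏ i ∈ (posFinset t ε p)ᶜ, Ring.inverse (vecQ (oFactor ρ α t ε p i (Y.filter (· < i)).card))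

variable {ρ : Representation k W V} {α : Refl cs → V} {t : Fin n → Refl cs}
  {ε : Fin n → Bool} {p : Refl cs}

/-- `chi M Y` counts pairs `y ≤ i`, the left side pairs `y < i`; the diagonal pairs account for
`(-1)^|Y|`. -/
theorem prod_neg_one_pow_card_lt {Q : Type*} [CommRing Q] {M Y : Finset (Fin n)} (hY : Y ⊆ M) :
    ∏ i ∈ M, (-1 : Q) ^ (Y.filter (· < i)).card = (-1) ^ Y.card * chi Q M Y := by
  have h1 : (-1 : Q) ^ Y.card = ∏ i ∈ M, if i ∈ Y then (-1 : Q) else 1 := by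
    rw [prod_ite_mem, inter_eq_right.2 hY, prod_const]
  rw [chi_eq_prod, prod_comm, h1, ← prod_mul_distrib]
  refine prod_congr rfl fun i _ => ?_
  rw [← prod_filter, prod_const]
  split_ifs with h
  · have : Y.filter (· ≤ i) = insert i (Y.filter (· < i)) := by
      ext y
      simp only [mem_filter, mem_insert, le_iff_eq_or_lt]
      constructor
      · rintro ⟨hy, h | h⟩
        · exact Or.inl h
        · exact Or.inr ⟨hy, h⟩
      · rintro (rfl | ⟨hy, h⟩)
        · exact ⟨h, Or.inl rfl⟩
        · exact ⟨hy, Or.inr h⟩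
    rw [this, card_insert_of_notMem (by simp), pow_succ]
    ring
  · have : Y.filter (· ≤ i) = Y.filter (· < i) := by
      refine filter_congr fun y hy => ?_
      have : y ≠ i := fun h' => h (h' ▸ hy)
      exact ⟨fun hle => lt_of_le_of_ne hle this, le_of_lt⟩
    rw [this, one_mul]

theorem isRoot_oFactor (hα : ∀ p : Refl cs, IsRoot ρ p.1 (α p)) (i : Fin n) (m : ℕ) :
    IsRoot ρ (p.1 ^ m * (reflAt t ε i).1 * (p.1 ^ m)⁻¹) (oFactor ρ α t ε p i m) := by
  have h := (hα (t i)).conj (p.1 ^ m * before t ε i)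
  have h1 : p.1 ^ m * before t ε i * (t i).1 * (p.1 ^ m * before t ε i)⁻¹ =
    p.1 ^ m * (reflAt t ε i).1 * (p.1 ^ m)⁻¹ := by simp only [reflAt]; group
  rwa [h1] at h

theorem oFactor_succ (i : Fin n) (m : ℕ) :
    oFactor ρ α t ε p i (m + 1) = ρ p.1 (oFactor ρ α t ε p i m) := by
  simp only [oFactor, pow_succ', mul_assoc, map_mul, Module.End.mul_apply]

theorem oFactor_add_two (i : Fin n) (m : ℕ) :
    oFactor ρ α t ε p i (m + 2) = oFactor ρ α t ε p i m := by
  rw [oFactor_succ, oFactor_succ, ← Module.End.mul_apply, ← map_mul, p.2.mul_self, map_one,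
    Module.End.one_apply]

theorem oFactor_of_mem (h2 : (2 : k) ≠ 0) (hα : ∀ p : Refl cs, IsRoot ρ p.1 (α p)) {i : Fin n}
    (hi : i ∈ posFinset t ε p) :
    ∃ c : k, c ≠ 0 ∧ ∀ m, oFactor ρ α t ε p i m = ((-1) ^ m * c) • α p := by
  have h := isRoot_oFactor (p := p) (ε := ε) (t := t) hα i 0
  rw [(mem_posFinset t).1 hi] at h
  obtain ⟨c, hc, h⟩ := IsRoot.exists_smul h2 (by simpa using h) (hα p)
  refine ⟨c, hc, fun m => ?_⟩
  induction m with
  | zero => simpa using h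
  | succ m ih => rw [oFactor_succ, ih, map_smul, (hα p).act_self, pow_succ]; simp

/-- Divisibility would make the two roots proportional. By the GKM-condition the reflection at `i`,
conjugated by a power of `p`, would be `p`, so `i` would lie in `M_p(ε)`. -/
theorem not_dvd_oFactor (h2 : (2 : k) ≠ 0) (hα : ∀ p : Refl cs, IsRoot ρ p.1 (α p))
    (hGKM : ∀ p q : Refl cs, (∃ c : k, c ≠ 0 ∧ α p = c • α q) → p = q) {i : Fin n}
    (hi : i ∉ posFinset t ε p) (m : ℕ) : ¬ ι k V (α p) ∣ ι k V (oFactor ρ α t ε p i m) := by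
  have h := isRoot_oFactor (p := p) (ε := ε) (t := t) hα i m
  refine (hα p).not_ι_dvd h2 (h.ne_zero h2) fun c hc hcα => ?_
  let q : Refl cs := ⟨_, (reflAt t ε i).2.conj (p.1 ^ m)⟩
  obtain ⟨d, hd, hq⟩ := IsRoot.exists_smul h2 (hα q) h
  have hqp : q = p := hGKM q p ⟨d * c, mul_ne_zero hd hc, by rw [hq, hcα, mul_smul]⟩
  refine hi ((mem_posFinset t).2 (Subtype.ext ?_))
  have h1 : p.1 ^ m * (reflAt t ε i).1 * (p.1 ^ m)⁻¹ = p.1 := congrArg Subtype.val hqp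
  rw [mul_inv_eq_iff_eq_mul, ← ((Commute.refl p.1).pow_left m).eq] at h1
  exact mul_left_cancel h1

/-- Each factor depends only on the parity of the number of flips before `i`, and applying `p`
changes a vector by a multiple of `α_p`. -/
theorem fourierDvd_oFunOff (h2 : (2 : k) ≠ 0) (hα : ∀ p : Refl cs, IsRoot ρ p.1 (α p))
    (hα0 : ∀ p, α p ≠ 0) (M : Finset (Fin n)) :
    FourierDvd (locR hα0 p) (vecQ (α p)) M id (oFunOff ρ α t ε p) := by
  refine FourierDvd.prod (vecQ_mem_rRing _) halfQ_mem (two_mul_halfQ h2) _ fun i _ => ?_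
  refine fourierDvd_parity (vecQ_mem_rRing _) halfQ_mem (two_mul_halfQ h2) i
    (v := fun m => vecQ (oFactor ρ α t ε p i m)) (vecQ_mem_rRing _) ?_
    fun m => by rw [oFactor_add_two]
  obtain ⟨f, -, hf⟩ := hα p
  rw [oFactor_succ, hf, ← vecQ_sub, sub_sub_cancel, vecQ_smul]
  exact mul_mem_powMod_left (algebraMap_mem_rRing _) (by simpa using pow_mem_powMod 1)

theorem inverse_sub_inverse {Q : Type*} [CommRing Q] {x y : Q} (hx : IsUnit x) (hy : IsUnit y) :
    Ring.inverse x - Ring.inverse y = -(Ring.inverse x * Ring.inverse y) * (x - y) := by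
  linear_combination Ring.inverse y * Ring.mul_inverse_cancel x hx
    - Ring.inverse x * Ring.mul_inverse_cancel y hy

theorem fourierDvd_oFunOffInv (h2 : (2 : k) ≠ 0) (hα : ∀ p : Refl cs, IsRoot ρ p.1 (α p))
    (hGKM : ∀ p q : Refl cs, (∃ c : k, c ≠ 0 ∧ α p = c • α q) → p = q)
    (hα0 : ∀ p, α p ≠ 0) (M : Finset (Fin n)) :
    FourierDvd (locR hα0 p) (vecQ (α p)) M id (oFunOffInv ρ α t ε p) := by
  refine FourierDvd.prod (vecQ_mem_rRing _) halfQ_mem (two_mul_halfQ h2) _ fun i hi => ?_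
  have hi : i ∉ posFinset t ε p := mem_compl.1 hi
  have hm := fun m => inverse_vecQ_mem (hv := hα0 p) (not_dvd_oFactor h2 hα hGKM hi m)
  have hu := fun m => isUnit_vecQ (k := k)
    ((isRoot_oFactor (p := p) (ε := ε) (t := t) hα i m).ne_zero h2)
  refine fourierDvd_parity (vecQ_mem_rRing _) halfQ_mem (two_mul_halfQ h2) i
    (v := fun m => Ring.inverse (vecQ (oFactor ρ α t ε p i m))) (hm 0) ?_
    fun m => by rw [oFactor_add_two]
  simp only [inverse_sub_inverse (hu 0) (hu 1)]
  refine mul_mem_powMod_left (neg_mem (mul_mem (hm 0) (hm 1))) ?_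
  obtain ⟨f, -, hf⟩ := hα p
  rw [oFactor_succ, hf, ← vecQ_sub, sub_sub_cancel, vecQ_smul]
  exact mul_mem_powMod_left (algebraMap_mem_rRing _) (by simpa using pow_mem_powMod 1)

theorem oFunOff_mul_inv (h2 : (2 : k) ≠ 0) (hα : ∀ p : Refl cs, IsRoot ρ p.1 (α p))
    (Y : Finset (Fin n)) : oFunOff ρ α t ε p Y * oFunOffInv ρ α t ε p Y = 1 := by
  rw [oFunOff, oFunOffInv, ← prod_mul_distrib]
  exact prod_eq_one fun i _ => Ring.mul_inverse_cancel _
    (isUnit_vecQ ((isRoot_oFactor hα i _).ne_zero h2))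

/-- On a half cube, `o` is the product of a unit, a power of the root, a sign, and `oFunOff`. -/
theorem exists_inverse_oFun_flip (h2 : (2 : k) ≠ 0) (hα : ∀ p : Refl cs, IsRoot ρ p.1 (α p))
    (hα0 : ∀ p, α p ≠ 0) (t : Fin n → Refl cs) (ε : Fin n → Bool) (p : Refl cs) :
    ∃ c ∈ locR hα0 p, ∃ c' ∈ locR hα0 p, c * c' = 1 ∧
      ∀ Y ⊆ posFinset t ε p, Even Y.card →
        vecQ (α p) ^ (posFinset t ε p).card * Ring.inverse (oFun ρ α t (flip Y ε)) =
          c' * chi _ (posFinset t ε p) Y * oFunOffInv ρ α t ε p Y := by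
  have hc : ∀ i, ∃ c : k, i ∈ posFinset t ε p → c ≠ 0 ∧
      ∀ m, oFactor ρ α t ε p i m = ((-1) ^ m * c) • α p := fun i => by
    by_cases hi : i ∈ posFinset t ε p
    · obtain ⟨c, hc⟩ := oFactor_of_mem h2 hα hi
      exact ⟨c, fun _ => hc⟩
    · exact ⟨0, fun h => absurd h hi⟩
  choose c hc using hc
  have hC : (∏ i ∈ posFinset t ε p, c i) * (∏ i ∈ posFinset t ε p, c i)⁻¹ = 1 :=
    mul_inv_cancel₀ (prod_ne_zero_iff.2 fun i hi => (hc i hi).1)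
  refine ⟨_, algebraMap_mem_rRing
      (algebraMap k (SymmetricAlgebra k V) (∏ i ∈ posFinset t ε p, c i)), _, algebraMap_mem_rRing
      (algebraMap k (SymmetricAlgebra k V) (∏ i ∈ posFinset t ε p, c i)⁻¹), ?_,
    fun Y hY hev => ?_⟩
  · rw [← map_mul, ← map_mul, hC, map_one, map_one]
  have h1 : oFun ρ α t (flip Y ε) =
      algebraMap _ _ (algebraMap k (SymmetricAlgebra k V) (∏ i ∈ posFinset t ε p, c i)) *
        vecQ (α p) ^ (posFinset t ε p).card * chi _ (posFinset t ε p) Y *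
          oFunOff ρ α t ε p Y := by
    have h3 : oFun ρ α t (flip Y ε) =
        ∏ i, vecQ (oFactor ρ α t ε p i (Y.filter (· < i)).card) :=
      prod_congr rfl fun i _ => by rw [before_flip hY, oFactor]
    rw [h3, ← prod_mul_prod_compl (posFinset t ε p), oFunOff]
    congr 1
    have h4 := prod_neg_one_pow_card_lt (Q := QRing k V) hY
    -- For even `|Y|` the signs at the positions in `M_p(ε)` multiply to exactly `chi M Y`.
    rw [hev.neg_one_pow, one_mul] at h4
    rw [← h4, map_prod, map_prod, ← prod_const, ← prod_mul_distrib, ← prod_mul_distrib]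
    refine prod_congr rfl fun i hi => ?_
    rw [(hc i hi).2, vecQ_smul]
    simp only [map_mul, map_pow, map_neg, map_one]
    ring
  rw [eq_comm, Ring.eq_mul_inverse_iff_mul_eq _ _ _ (isUnit_oFun ρ α hα0 t _), h1]
  have h5 := oFunOff_mul_inv (t := t) (ε := ε) (p := p) h2 hα Y
  have h6 := chi_mul_self (Q := QRing k V) (posFinset t ε p) Y
  have h7 : algebraMap _ (QRing k V) (algebraMap k (SymmetricAlgebra k V)
      (∏ i ∈ posFinset t ε p, c i)) * algebraMap _ _ (algebraMap k (SymmetricAlgebra k V)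
        (∏ i ∈ posFinset t ε p, c i)⁻¹) = 1 := by
    rw [← map_mul, ← map_mul, hC, map_one, map_one]
  generalize algebraMap (SymmetricAlgebra k V) (QRing k V) _ = x at *
  generalize algebraMap (SymmetricAlgebra k V) (QRing k V) _ = y at *
  generalize chi (QRing k V) _ _ = z at *
  generalize oFunOff ρ α t ε p Y = u at *
  generalize oFunOffInv ρ α t ε p Y = v at *
  linear_combination (vecQ (α p) ^ (posFinset t ε p).card) * (x * y * z * z * h5 + x * y * h6 + h7)

end OFun

/-! ### Test functions -/

section Test

variable {k : Type*} [Field k] {V : Type*} [AddCommGroup V] [Module k V]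
  {W : Type*} [Group W] {B : Type*} {C : CoxeterMatrix B} {cs : CoxeterSystem C W} {n : ℕ}

open Classical in
/-- A product of roots in which all roots `α_p` with `P p` at the positions of subexpressions occur
with a large multiplicity. -/
def dSym (α : Refl cs → V) (t : Fin n → Refl cs) (P : Refl cs → Prop) : SymmetricAlgebra k V :=
  ∏ x : (Fin n → Bool) × Fin n × Fin n with P (reflAt t x.1 x.2.1),
    ι k V (α (reflAt t x.1 x.2.1))

/-- `dSym` as an element of `Q`. -/
def dQ (α : Refl cs → V) (t : Fin n → Refl cs) (P : Refl cs → Prop) : QRing k V :=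
  algebraMap (SymmetricAlgebra k V) _ (dSym α t P)

variable {α : Refl cs → V} {σ : Submonoid (SymmetricAlgebra k V)} {t : Fin n → Refl cs} {w : W}

theorem dSym_ne_zero (hα0 : ∀ p, α p ≠ 0) (P : Refl cs → Prop) : dSym (k := k) α t P ≠ 0 :=
  prod_ne_zero_iff.2 fun _ _ => (prime_ι (hα0 _)).ne_zero

theorem exists_dSym_mem (P : Refl cs → Prop) : ∃ b, dSym α t P ∈ symGr k V b :=
  ⟨_, prod_ι_mem_symGr _ _⟩

theorem dQ_eq_prod (P : Refl cs → Prop) [DecidablePred P] : (dQ α t P : QRing k V) =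
    ∏ x : (Fin n → Bool) × Fin n × Fin n with P (reflAt t x.1 x.2.1),
      vecQ (α (reflAt t x.1 x.2.1)) := by
  rw [dQ, dSym, map_prod]
  congr!

theorem dQ_mem (P : Refl cs → Prop) : dQ α t P ∈ rRing σ := algebraMap_mem_rRing _

theorem dQ_mul_mem {P : Refl cs → Prop} {q : Refl cs} (hq : P q) {ε : Fin n → Bool}
    {X : Finset (Fin n)} (hX : X ⊆ posFinset t ε q) {x : QRing k V} (hx : x ∈ rRing σ) :
    dQ α t P * x ∈ powMod (rRing σ) (vecQ (α q)) X.card := by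
  classical
  rcases X.eq_empty_or_nonempty with rfl | ⟨i, hi⟩
  · exact powMod_zero.2 ((rRing σ).mul_mem (dQ_mem P) hx)
  have hi := (mem_posFinset t).1 (hX hi)
  refine powMod_anti (vecQ_mem_rRing _) (card_le_univ X) ?_
  rw [Fintype.card_fin]
  -- The idle third index provides `n` copies of the root at position `i`, enough since `|X| ≤ n`.
  let S : Finset ((Fin n → Bool) × Fin n × Fin n) := univ.image fun j => (ε, i, j)
  have hS : S ⊆ univ.filter fun x => P (reflAt t x.1 x.2.1) := by
    intro x hx
    obtain ⟨j, -, rfl⟩ := mem_image.1 hx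
    simp [hi, hq]
  rw [dQ_eq_prod, ← prod_sdiff hS, mul_right_comm]
  refine mul_mem_powMod_left ((rRing σ).mul_mem
    ((rRing σ).prod_mem fun _ _ => vecQ_mem_rRing _) hx) ?_
  rw [prod_image (fun j _ j' _ h => by simpa using h)]
  simp only [hi, prod_const, card_univ, Fintype.card_fin]
  exact pow_mem_powMod n

/-- The function supported on the class `{f_Y ε}`, `Y ⊆ M_p(ε)`, with the values `f Y`. -/
def bump (t : Fin n → Refl cs) (ε : Fin n → Bool) (p : Refl cs)
    (f : Finset (Fin n) → QRing k V) (ε' : Fin n → Bool) : QRing k V :=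
  if diffSet ε ε' ⊆ posFinset t ε p then f (diffSet ε ε') else 0

variable {ε : Fin n → Bool} {p : Refl cs} {f : Finset (Fin n) → QRing k V}

theorem bump_flip {Y : Finset (Fin n)} (hY : Y ⊆ posFinset t ε p) :
    bump t ε p f (flip Y ε) = f Y := by
  rw [bump, diffSet_flip, if_pos hY]

theorem bump_mem (hf : ∀ Y ⊆ posFinset t ε p, f Y ∈ rRing σ) (ε' : Fin n → Bool) :
    bump t ε p f ε' ∈ rRing σ := by
  unfold bump
  split_ifs with h
  · exact hf _ h
  · exact (rRing σ).zero_mem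

theorem sigmaAll_mul_left (X : Finset (Fin n)) (ε : Fin n → Bool) (c : QRing k V)
    (g : (Fin n → Bool) → QRing k V) :
    sigmaAll X ε (fun ε' => c * g ε') = c * sigmaAll X ε g := by
  rw [sigmaAll, sigmaAll, mul_sum]
  exact sum_congr rfl fun Y _ => by ring

theorem sigmaAll_mem {g : (Fin n → Bool) → QRing k V} (hg : ∀ ε, g ε ∈ rRing σ)
    (X : Finset (Fin n)) (ε : Fin n → Bool) : sigmaAll X ε g ∈ rRing σ :=
  (rRing σ).sum_mem fun Y _ => (rRing σ).mul_mem (chi_mem _ X Y) (hg _)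

theorem inX_dQ_mul {g : (Fin n → Bool) → QRing k V} (hg : ∀ ε, g ε ∈ rRing σ) :
    InX α σ t id fun ε => dQ α t (fun _ => True) * g ε := by
  refine ⟨fun ε => (rRing σ).mul_mem (dQ_mem _) (hg ε), fun ε q X hX => ?_⟩
  rw [sigmaAll_mul_left]
  exact dQ_mul_mem trivial hX (sigmaAll_mem hg X ε)

/-- The factor `dQ` settles the conditions at all roots other than `α_p`. At `α_p` each class is
either the support class, where `hF` applies, or disjoint from it. -/
theorem inX_bump (h2 : (2 : k) ≠ 0) (hα0 : ∀ p, α p ≠ 0)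
    (hf : ∀ Y ⊆ posFinset t ε p, f Y ∈ rRing σ)
    (hF : FourierDvd (locR hα0 p) (vecQ (α p)) (posFinset t ε p) id f) :
    InX α σ t id fun ε' => dQ α t (· ≠ p) * bump t ε p f ε' := by
  refine ⟨fun ε => (rRing σ).mul_mem (dQ_mem _) (bump_mem hf ε), fun ε' q X hX => ?_⟩
  rw [sigmaAll_mul_left]
  by_cases hq : q = p
  · subst hq
    refine mul_mem_powMod_left (dQ_mem _) ?_
    by_cases h : diffSet ε ε' ⊆ posFinset t ε q
    · rw [← flip_diffSet ε ε', posFinset_flip h] at hX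
      refine mem_powMod_rRing (hα0 q) (sigmaAll_mem (bump_mem hf) X ε') ?_
      rw [← flip_diffSet ε ε', sigmaAll_flip]
      refine Eq.subst (motive := (· ∈ _)) (sum_congr rfl fun Y hY => ?_)
        (hF.sum_mem (vecQ_mem_rRing _) halfQ_mem (two_mul_halfQ h2) monotone_id hX h)
      rw [bump_flip (symmDiff_subset ((mem_powerset.1 hY).trans hX) h)]
    · rw [sigmaAll, sum_eq_zero]
      · exact Submodule.zero_mem _
      · intro Y hY
        have hY := (mem_powerset.1 hY).trans hX
        rw [bump, if_neg, mul_zero]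
        intro h1
        have h3 : posFinset t ε' q = posFinset t ε q := by
          rw [← posFinset_flip hY, ← flip_diffSet ε (flip Y ε'), posFinset_flip h1]
        have h4 : ε' = flip (symmDiff Y (diffSet ε (flip Y ε'))) ε := by
          rw [← flip_flip, flip_diffSet, flip_flip, symmDiff_self]
          exact (flip_empty ε').symm
        rw [h3] at hY
        rw [h4, diffSet_flip] at h
        exact h (symmDiff_subset hY h1)
  · exact dQ_mul_mem hq hX (sigmaAll_mem (bump_mem hf) X ε')

theorem exists_dQ_mul_eq_one (h2 : (2 : k) ≠ 0) {ρ : Representation k W V}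
    (hα : ∀ p : Refl cs, IsRoot ρ p.1 (α p))
    (hGKM : ∀ p q : Refl cs, (∃ c : k, c ≠ 0 ∧ α p = c • α q) → p = q) (hα0 : ∀ p, α p ≠ 0)
    (t : Fin n → Refl cs) (p : Refl cs) :
    ∃ d ∈ locR (k := k) hα0 p, d * dQ α t (· ≠ p) = 1 := by
  classical
  refine ⟨∏ x : (Fin n → Bool) × Fin n × Fin n with reflAt t x.1 x.2.1 ≠ p,
    Ring.inverse (vecQ (α (reflAt t x.1 x.2.1))), (locR hα0 p).prod_mem fun x hx => ?_, ?_⟩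
  · refine inverse_vecQ_mem ((hα p).not_ι_dvd h2 (hα0 _) fun c hc h => ?_)
    exact (mem_filter.1 hx).2 (hGKM _ _ ⟨c, hc, h⟩)
  · rw [dQ_eq_prod, ← prod_mul_distrib]
    exact prod_eq_one fun x _ => Ring.inverse_mul_cancel _ (isUnit_vecQ (hα0 _))

end Test

/-! ### The pairing -/

section Pairing

variable {k : Type*} [Field k] {V : Type*} [AddCommGroup V] [Module k V]
  {W : Type*} [Group W] {B : Type*} {C : CoxeterMatrix B} {cs : CoxeterSystem C W} {n : ℕ}
  {ρ : Representation k W V} {α : Refl cs → V} {σ : Submonoid (SymmetricAlgebra k V)}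
  {t : Fin n → Refl cs} {w : W}

theorem pairing_comm (g h : SubTo t w → QRing k V) :
    pairing ρ α t w g h = pairing ρ α t w h g :=
  sum_congr rfl fun ε _ => by rw [mul_comm (g ε)]

theorem pairing_eq_sum (g : SubTo t w → QRing k V) (h : (Fin n → Bool) → QRing k V) :
    pairing ρ α t w g (fun ε => h ε.1) =
      ∑ ε, extendZero t g ε * h ε * Ring.inverse (oFun ρ α t ε) := by
  classical
  rw [← sum_filter_of_ne (p := fun ε => target t ε = w), pairing,
    sum_subtype _ (p := fun ε => target t ε = w) (fun ε => by simp)]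
  · exact sum_congr rfl fun ε _ => by rw [extendZero_coe]
  · intro ε _ h0
    by_contra hw
    rw [extendZero, dif_neg hw, zero_mul, zero_mul] at h0
    exact h0 rfl

theorem pairing_eq_sum_extendZero (g h : SubTo t w → QRing k V) :
    pairing ρ α t w g h =
      ∑ ε, extendZero t g ε * extendZero t h ε * Ring.inverse (oFun ρ α t ε) := by
  rw [← pairing_eq_sum]
  congr 1
  funext ε
  rw [extendZero_coe]

/-- A sum over all subexpressions is an average of sums over classes. -/
theorem sum_mem_of_sum_flip_mem {Q : Type*} [CommRing Q] {A : Subring Q} {r : Q} (hr : r ∈ A)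
    (h2 : 2 * r = 1) (p : Refl cs) (F : (Fin n → Bool) → Q)
    (h : ∀ ε, ∑ Y ∈ (posFinset t ε p).powerset, F (flip Y ε) ∈ A) : ∑ ε, F ε ∈ A := by
  have key : ∑ ε, r ^ (posFinset t ε p).card * ∑ Y ∈ (posFinset t ε p).powerset, F (flip Y ε) =
      ∑ ε, F ε := by
    have h1 : ∀ ε, F ε = ∑ Y ∈ (posFinset t ε p).powerset, r ^ (posFinset t ε p).card * F ε := by
      intro ε
      rw [sum_const, card_powerset, nsmul_eq_mul, ← mul_assoc]
      push_cast
      rw [← mul_pow, h2, one_pow, one_mul]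
    rw [sum_congr rfl fun ε _ => h1 ε]
    simp only [mul_sum]
    rw [sum_sigma', sum_sigma']
    -- The involution `(ε, Y) ↦ (f_Y ε, Y)` keeps `M_p`; each `ε` occurs `2^|M_p(ε)|` times, which
    -- the weight cancels.
    refine sum_bij' (fun x _ => ⟨flip x.2 x.1, x.2⟩) (fun x _ => ⟨flip x.2 x.1, x.2⟩) ?_ ?_ ?_ ?_ ?_
    · rintro ⟨ε, Y⟩ hx
      simp only [mem_sigma, mem_univ, mem_powerset, true_and] at hx ⊢
      rwa [posFinset_flip hx]
    · rintro ⟨ε, Y⟩ hx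
      simp only [mem_sigma, mem_univ, mem_powerset, true_and] at hx ⊢
      rwa [posFinset_flip hx]
    · rintro ⟨ε, Y⟩ hx
      simp only [flip_flip, symmDiff_self, bot_eq_empty, flip_empty]
    · rintro ⟨ε, Y⟩ hx
      simp only [flip_flip, symmDiff_self, bot_eq_empty, flip_empty]
    · rintro ⟨ε, Y⟩ hx
      simp only [mem_sigma, mem_univ, mem_powerset, true_and] at hx
      simp only [posFinset_flip hx]
  rw [← key]
  exact A.sum_mem fun ε _ => A.mul_mem (A.pow_mem hr _) (h ε)

theorem oFun_mem (ε : Fin n → Bool) : oFun ρ α t ε ∈ rRing σ :=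
  (rRing σ).prod_mem fun _ _ => vecQ_mem_rRing _

/-- Each factor of `o(ε)` is proportional to the root of its reflection, and the triples `(ε, i, i)`
select one matching factor of `dQ` for each `i`. -/
theorem dQ_true_mul_inverse_oFun_mem (h2 : (2 : k) ≠ 0)
    (hα : ∀ p : Refl cs, IsRoot ρ p.1 (α p)) (hα0 : ∀ p, α p ≠ 0) (ε : Fin n → Bool) :
    dQ α t (fun _ => True) * Ring.inverse (oFun ρ α t ε) ∈ rRing σ := by
  classical
  have h : ∀ i, ∃ c : k, α (reflAt t ε i) = c • ρ (before t ε i) (α (t i)) := fun i => by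
    obtain ⟨c, -, h⟩ := (hα (reflAt t ε i)).exists_smul h2 ((hα (t i)).conj (before t ε i))
    exact ⟨c, h⟩
  choose c hc using h
  let S : Finset ((Fin n → Bool) × Fin n × Fin n) := univ.image fun i => (ε, i, i)
  have hS : S ⊆ univ.filter fun x => True := by simp
  rw [dQ_eq_prod, ← prod_sdiff hS, mul_assoc]
  refine (rRing σ).mul_mem ((rRing σ).prod_mem fun _ _ => vecQ_mem_rRing _) ?_
  rw [prod_image (fun j _ j' _ h => by simpa using h)]
  simp only [hc, vecQ_smul, prod_mul_distrib]
  rw [← oFun, mul_assoc, Ring.mul_inverse_cancel _ (isUnit_oFun ρ α hα0 t ε), mul_one]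
  exact (rRing σ).prod_mem fun _ _ => algebraMap_mem_rRing _

theorem mem_rRing_of_dQ_mul (hα0 : ∀ p, α p ≠ 0) {x : QRing k V}
    (h1 : dQ α t (fun _ => True) * x ∈ rRing σ)
    (h : ∀ p, x ∈ locR hα0 p) : x ∈ rRing σ := by
  classical
  rw [dQ_eq_prod] at h1
  exact mem_rRing_of_prod_mul _ (fun x : (Fin n → Bool) × Fin n × Fin n => α (reflAt t x.1 x.2.1))
    (fun _ => hα0 _) h1 fun _ => h _

theorem pairing_mem (h2 : (2 : k) ≠ 0) (hα : ∀ p : Refl cs, IsRoot ρ p.1 (α p))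
    (hGKM : ∀ p q : Refl cs, (∃ c : k, c ≠ 0 ∧ α p = c • α q) → p = q) {hα0 : ∀ p, α p ≠ 0}
    (hσ : ∀ p, σ ≤ notDvd (α p) (hα0 p)) {g h : SubTo t w → QRing k V} (hg : g ∈ XLower α σ t w)
    (hh : h ∈ XUpper α σ t w) : pairing ρ α t w g h ∈ rRing σ := by
  rw [mem_XLower] at hg
  rw [mem_XUpper] at hh
  rw [pairing_eq_sum_extendZero]
  refine mem_rRing_of_dQ_mul (t := t) hα0 ?_ fun p => ?_
  · rw [mul_sum]
    refine (rRing σ).sum_mem fun ε _ => ?_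
    rw [mul_left_comm]
    exact (rRing σ).mul_mem ((rRing σ).mul_mem (hg.1 ε) (hh.1 ε))
      (dQ_true_mul_inverse_oFun_mem h2 hα hα0 ε)
  -- A class with base point in `Sub(t, w)` contributes, after multiplication by `α_p^|M|`, a
  -- constant times the coefficient at `M` of `g * (h * oFunOffInv)`.
  · have key : ∀ ε, target t ε = w → ∑ Y ∈ (posFinset t ε p).powerset,
        extendZero t g (flip Y ε) * extendZero t h (flip Y ε) *
          Ring.inverse (oFun ρ α t (flip Y ε)) ∈ locR hα0 p := by
      intro ε hε
      obtain ⟨c, -, c', hc', -, ho⟩ := exists_inverse_oFun_flip h2 hα hα0 t ε p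
      have hg0 : ∀ Y ⊆ posFinset t ε p, ¬ Even Y.card → extendZero t g (flip Y ε) = 0 :=
        fun Y hY => extendZero_flip_of_not_even g hε hY
      have hh0 : ∀ Y ⊆ posFinset t ε p, ¬ Even Y.card → extendZero t h (flip Y ε) = 0 :=
        fun Y hY => extendZero_flip_of_not_even h hε hY
      have h3 := FourierDvd.fourier_mul_mem (vecQ_mem_rRing _) halfQ_mem (two_mul_halfQ h2)
        (hg.fourierDvd h2 hσ ε p)
        ((hh.fourierDvd h2 hσ ε p).mul (vecQ_mem_rRing _) halfQ_mem (two_mul_halfQ h2)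
          (fourierDvd_oFunOffInv (t := t) (ε := ε) h2 hα hGKM hα0 _)) hg0
        fun Y hY hev => by rw [hh0 Y hY hev, zero_mul]
      refine powMod_zero.1 (mem_powMod_of_pow_mul (isUnit_vecQ (hα0 p))
        (l := (posFinset t ε p).card) ?_)
      have h4 := mul_mem_powMod_left hc' h3
      rw [add_zero]
      refine Eq.subst (motive := (· ∈ _)) ?_ h4
      rw [fourier, mul_sum, mul_sum]
      refine sum_congr rfl fun Y hY => ?_
      by_cases hev : Even Y.card
      · linear_combination - extendZero t g (flip Y ε) * extendZero t h (flip Y ε) *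
          ho Y (mem_powerset.1 hY) hev
      · rw [hg0 Y (mem_powerset.1 hY) hev]
        ring
    refine sum_mem_of_sum_flip_mem (t := t) halfQ_mem (two_mul_halfQ h2) p _ fun ε => ?_
    by_cases h : ∃ Z ⊆ posFinset t ε p, target t (flip Z ε) = w
    · obtain ⟨Z, hZ, hw⟩ := h
      have h5 := key _ hw
      rw [posFinset_flip hZ] at h5
      rw [← sum_powerset_symmDiff hZ]
      simpa only [flip_flip] using h5
    · refine (locR hα0 p).sum_mem fun Y hY => ?_
      rw [extendZero, dif_neg, zero_mul, zero_mul]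
      · exact (locR hα0 p).zero_mem
      · exact fun hw => h ⟨Y, mem_powerset.1 hY, hw⟩

end Pairing

/-! ### Duality -/

section Duality

variable {k : Type*} [Field k] {V : Type*} [AddCommGroup V] [Module k V]
  {W : Type*} [Group W] {B : Type*} {C : CoxeterMatrix B} {cs : CoxeterSystem C W} {n : ℕ}
  {ρ : Representation k W V} {α : Refl cs → V} {σ : Submonoid (SymmetricAlgebra k V)}
  {t : Fin n → Refl cs} {w : W}

theorem sum_mul_bump (ε : Fin n → Bool) (p : Refl cs) (f : Finset (Fin n) → QRing k V)
    (F : (Fin n → Bool) → QRing k V) :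
    ∑ ε', F ε' * bump t ε p f ε' =
      ∑ Y ∈ (posFinset t ε p).powerset, F (flip Y ε) * f Y := by
  classical
  rw [← sum_subset (subset_univ ((posFinset t ε p).powerset.image fun Y => flip Y ε)), sum_image]
  · exact sum_congr rfl fun Y hY => by rw [bump_flip (mem_powerset.1 hY)]
  · intro Y _ Z _ h
    rw [← diffSet_flip Y ε, ← diffSet_flip Z ε]
    exact congrArg (diffSet ε) h
  · intro ε' _ h
    rw [bump, if_neg, mul_zero]
    exact fun h1 => h (mem_image.2 ⟨_, mem_powerset.2 h1, flip_diffSet ε ε'⟩)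

/-- The pairing with a test function is essentially a Fourier coefficient. -/
theorem fourier_mem_of_pairing_mem (h2 : (2 : k) ≠ 0) (hα : ∀ p : Refl cs, IsRoot ρ p.1 (α p))
    (hGKM : ∀ p q : Refl cs, (∃ c : k, c ≠ 0 ∧ α p = c • α q) → p = q) {hα0 : ∀ p, α p ≠ 0}
    (hσ : ∀ p, σ ≤ notDvd (α p) (hα0 p)) {g : SubTo t w → QRing k V} {ε : Fin n → Bool}
    (hε : target t ε = w) (p : Refl cs) {f : Finset (Fin n) → QRing k V}
    (h : pairing ρ α t w g (fun ε' => dQ α t (· ≠ p) *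
      bump t ε p (fun Y => oFunOff ρ α t ε p Y * f Y) ε'.1) ∈ rRing σ) :
    fourier (posFinset t ε p) (fun Y => f Y * extendZero t g (flip Y ε)) (posFinset t ε p) ∈
      powMod (locR hα0 p) (vecQ (α p)) (posFinset t ε p).card := by
  obtain ⟨c, hc, c', -, hcc', ho⟩ := exists_inverse_oFun_flip h2 hα hα0 t ε p
  obtain ⟨d, hd, hdd⟩ := exists_dQ_mul_eq_one h2 hα hGKM hα0 t p
  refine mem_powMod.2 ⟨_, mul_mem (mul_mem hd hc) (rRing_mono (hσ p) h), ?_⟩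
  rw [pairing_eq_sum g fun ε' => dQ α t (· ≠ p) *
    bump t ε p (fun Y => oFunOff ρ α t ε p Y * f Y) ε']
  have h1 : ∀ ε', extendZero t g ε' * (dQ α t (· ≠ p) *
        bump t ε p (fun Y => oFunOff ρ α t ε p Y * f Y) ε') * Ring.inverse (oFun ρ α t ε') =
      (extendZero t g ε' * dQ α t (· ≠ p) * Ring.inverse (oFun ρ α t ε')) *
        bump t ε p (fun Y => oFunOff ρ α t ε p Y * f Y) ε' := fun ε' => by ring
  simp only [h1]
  rw [sum_mul_bump, fourier, mul_sum, mul_sum]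
  refine sum_congr rfl fun Y hY => ?_
  have hY := mem_powerset.1 hY
  by_cases hev : Even Y.card
  · have h3 := ho Y hY hev
    have h4 := oFunOff_mul_inv (t := t) (ε := ε) (p := p) h2 hα Y
    generalize extendZero t g (flip Y ε) = G at *
    generalize (dQ α t (· ≠ p) : QRing k V) = D at *
    generalize oFunOff ρ α t ε p Y = u at *
    generalize oFunOffInv ρ α t ε p Y = v at *
    generalize chi (QRing k V) _ _ = x at *
    linear_combination (-(d * c * G * D * u * f Y)) * h3 - (d * D * c * c' * x * G * f Y) * h4 -
      (d * D * x * G * f Y) * hcc' - (x * G * f Y) * hdd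
  · rw [extendZero_flip_of_not_even g hε hY hev]
    ring

theorem pred_mono : Monotone Nat.pred := fun _ _ h => Nat.pred_le_pred h

/-- The character of `symmDiff M I` moves the coefficient at `I` to the index `M`, the one visible
to the pairing. -/
theorem fourier_pow_mul_chi_mul {Q : Type*} [CommRing Q] {a : Q} (ha : IsUnit a) {A : Subring Q}
    {M I : Finset (Fin n)} {l : ℕ} (hl : l ≤ M.card) {G : Finset (Fin n) → Q}
    (h : fourier M (fun Y => a ^ l * chi Q (symmDiff M I) Y * G Y) M ∈ powMod A a M.card) :
    fourier M G I ∈ powMod A a (M.card - l) := by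
  simp only [mul_assoc] at h
  rw [fourier_const_mul, fourier_chi_mul, symmDiff_symmDiff_cancel_left] at h
  refine mem_powMod_of_pow_mul ha (l := l) ?_
  rwa [Nat.add_sub_cancel' hl]

theorem card_symmDiff_of_subset {M I : Finset (Fin n)} (hI : I ⊆ M) :
    (symmDiff M I).card = M.card - I.card := by
  have h : symmDiff M I = M \ I := symmDiff_of_ge hI
  rw [h, card_sdiff_of_subset hI]

theorem oFunOff_mem (ε : Fin n → Bool) (p : Refl cs) (Y : Finset (Fin n)) :
    oFunOff ρ α t ε p Y ∈ rRing σ :=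
  (rRing σ).prod_mem fun _ _ => vecQ_mem_rRing _

theorem restrict_mem_YLower {h : (Fin n → Bool) → QRing k V} (hh : InX α σ t id h) :
    (fun ε : SubTo t w => h ε.1) ∈ YLower α σ t w := ⟨h, mem_XAll.2 hh, rfl⟩

theorem XUpper_le_YLower : XUpper α σ t w ≤ YLower α σ t w := fun g hg => by
  have := restrict_mem_YLower (w := w) (mem_XUpper.1 hg)
  simpa only [extendZero_coe] using this

theorem restrict_mem_XUpper {h : (Fin n → Bool) → QRing k V} (hh : InX α σ t id h)
    (h0 : ∀ ε, target t ε ≠ w → h ε = 0) : (fun ε : SubTo t w => h ε.1) ∈ XUpper α σ t w := by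
  rw [mem_XUpper]
  have : extendZero t (fun ε : SubTo t w => h ε.1) = h := by
    funext ε
    unfold extendZero
    split_ifs with hw
    · rfl
    · exact (h0 ε hw).symm
  rwa [this]

open Classical in
theorem single_mem_XUpper (ε : SubTo t w) :
    Pi.single ε (dQ α t fun _ => True) ∈ XUpper α σ t w := by
  have h1 := inX_dQ_mul (α := α) (σ := σ) (t := t)
    (g := fun ε' => if ε' = ε.1 then (1 : QRing k V) else 0) fun ε' => by
      split_ifs
      · exact (rRing σ).one_mem
      · exact (rRing σ).zero_mem
  have h3 := restrict_mem_XUpper (w := w) h1 fun ε' hw => by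
    rw [if_neg, mul_zero]
    rintro rfl
    exact hw ε.2
  convert! h3 using 1
  funext ε'
  rw [Pi.single_apply]
  by_cases h : ε' = ε
  · simp [h]
  · rw [if_neg h, if_neg (fun h' => h (Subtype.ext h')), mul_zero]

theorem pairing_single [DecidableEq (SubTo t w)] (g : SubTo t w → QRing k V) (ε : SubTo t w)
    (c : QRing k V) :
    pairing ρ α t w g (Pi.single ε c) = g ε * c * Ring.inverse (oFun ρ α t ε.1) := by
  rw [pairing, sum_eq_single ε]
  · rw [Pi.single_eq_same]
  · intro ε' _ h
    rw [Pi.single_eq_of_ne h, mul_zero, zero_mul]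
  · exact fun h => (h (@mem_univ _ (_) _)).elim

/-- A function is in the module given by `e` if all its Fourier coefficients are suitably divisible
and its pairings with the simplest test functions are in `R`. -/
theorem inX_extendZero_of_fourierDvd (h2 : (2 : k) ≠ 0) {hα0 : ∀ p, α p ≠ 0} {e : ℕ → ℕ}
    (he : Monotone e) {g : SubTo t w → QRing k V}
    (hF : ∀ (ε : SubTo t w) (p : Refl cs), FourierDvd (locR hα0 p) (vecQ (α p))
      (posFinset t ε.1 p) e fun Y => extendZero t g (flip Y ε.1))
    (hg : g ∈ dualMod ρ α σ t w (XUpper α σ t w)) : InX α σ t e (extendZero t g) := by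
  classical
  have h1 : ∀ ε, g ε ∈ rRing σ := fun ε => by
    refine mem_rRing_of_dQ_mul (t := t) hα0 ?_ fun p => ?_
    · have h3 := hg _ (single_mem_XUpper ε)
      rw [pairing_single] at h3
      have h4 := (rRing σ).mul_mem (oFun_mem (ρ := ρ) (α := α) (t := t) ε.1) h3
      rwa [mul_comm (g ε), mul_left_comm, Ring.mul_inverse_cancel _ (isUnit_oFun ρ α hα0 t ε.1),
        mul_one] at h4
    · have h3 := (hF ε p).apply_mem (vecQ_mem_rRing _) halfQ_mem (two_mul_halfQ h2) he
        (empty_subset _)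
      simpa only [flip_empty, extendZero_coe] using h3
  exact inX_extendZero_iff.2 ⟨h1, fun ε p X hX =>
    (hF ε p).sigmaAll_mem h2 he (extendZero_mem h1) hX⟩

theorem dualMod_anti {N N' : Submodule (rRing σ) (SubTo t w → QRing k V)} (h : N ≤ N') :
    dualMod ρ α σ t w N' ≤ dualMod ρ α σ t w N := fun _ hg m hm => hg m (h hm)

/-! ### Dual modules of `Y_w`, `X_w` and `X^w`. -/

variable (h2 : (2 : k) ≠ 0) (hα : ∀ p : Refl cs, IsRoot ρ p.1 (α p))
  (hGKM : ∀ p q : Refl cs, (∃ c : k, c ≠ 0 ∧ α p = c • α q) → p = q) {hα0 : ∀ p, α p ≠ 0}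
  (hσ : ∀ p, σ ≤ notDvd (α p) (hα0 p))

-- The test function uses `α_p^{|M| - |I|} chi (symmDiff M I)`, the least power allowed for that
-- character. The coefficient of `g` at `I` keeps the remaining `α_p^{|I|}`.
include h2 hα hGKM hσ in
theorem dualMod_YLower_le : dualMod ρ α σ t w (YLower α σ t w) ≤ XUpper α σ t w := fun g hg => by
  rw [mem_XUpper]
  refine inX_extendZero_of_fourierDvd h2 (hα0 := hα0) monotone_id (fun ε p I hI => ?_)
    (dualMod_anti XUpper_le_YLower hg)
  have hc := card_symmDiff_of_subset hI
  have h1 := fourier_pow_mul_chi_mul (A := locR hα0 p) (I := I) (isUnit_vecQ (k := k) (hα0 p))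
    (Nat.sub_le _ I.card) (G := fun Y => extendZero t g (flip Y ε.1))
    (fourier_mem_of_pairing_mem h2 hα hGKM hσ ε.2 p
      (hg _ (restrict_mem_YLower (inX_bump h2 hα0 ?_ ?_))))
  · rwa [Nat.sub_sub_self (card_le_card hI)] at h1
  · intro Y _
    exact mul_mem (oFunOff_mem _ _ _) (mul_mem (pow_mem (vecQ_mem_rRing _) _) (chi_mem _ _ _))
  · refine (fourierDvd_oFunOff h2 hα hα0 _).mul (vecQ_mem_rRing _) halfQ_mem (two_mul_halfQ h2)
      (fourierDvd_chi (symmDiff_subset Subset.rfl hI) ?_)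
    rw [hc]
    exact pow_mem_powMod _

-- Test functions must now vanish off `Sub(t, w)`. Restricting to even `Y` requires one more `α_p`,
-- so only `α_p^{|I| - 1}` remains.
include h2 hα hGKM hσ in
theorem dualMod_XUpper_le : dualMod ρ α σ t w (XUpper α σ t w) ≤ XLower α σ t w := fun g hg => by
  rw [mem_XLower]
  refine inX_extendZero_of_fourierDvd h2 (hα0 := hα0) pred_mono (fun ε p I hI => ?_) hg
  set M := posFinset t ε.1 p with hM
  have hg0 : ∀ Y ⊆ M, ¬ Even Y.card → extendZero t g (flip Y ε.1) = 0 :=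
    fun Y hY => extendZero_flip_of_not_even g ε.2 hY
  have key : ∀ {f : Finset (Fin n) → QRing k V}, (∀ Y, f Y ∈ rRing σ) →
      (∀ Y ⊆ M, ¬ Even Y.card → f Y = 0) → FourierDvd (locR hα0 p) (vecQ (α p)) M id f →
      fourier M (fun Y => f Y * extendZero t g (flip Y ε.1)) M ∈
        powMod (locR hα0 p) (vecQ (α p)) M.card := by
    intro f hf hf0 hfF
    refine fourier_mem_of_pairing_mem h2 hα hGKM hσ ε.2 p
      (hg _ (restrict_mem_XUpper (inX_bump h2 hα0 ?_ ?_) ?_))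
    · exact fun Y _ => mul_mem (oFunOff_mem _ _ _) (hf Y)
    · exact (fourierDvd_oFunOff h2 hα hα0 _).mul (vecQ_mem_rRing _) halfQ_mem (two_mul_halfQ h2) hfF
    · intro ε' hw
      rw [bump]
      split_ifs with hd
      · rw [hf0 _ hd, mul_zero, mul_zero]
        rwa [← even_card_of_target_flip hd, flip_diffSet, ε.2]
      · rw [mul_zero]
  rcases M.eq_empty_or_nonempty with h0 | h0
  · rw [h0] at hI key ⊢
    obtain rfl := subset_empty.1 hI
    have h1 := key (f := fun _ => 1) (fun _ => one_mem _)
      (fun Y hY h => absurd (by simp [subset_empty.1 hY]) h) (fourierDvd_const (one_mem _))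
    simpa using h1
  -- Nonemptiness ensures that the total power `|M| - |I| + 1` does not exceed `|M|`.
  have main : ∀ I ⊆ M, I.Nonempty → fourier M (fun Y => extendZero t g (flip Y ε.1)) I ∈
      powMod (locR hα0 p) (vecQ (α p)) (Nat.pred I.card) := by
    intro I hI hI0
    have hc := card_symmDiff_of_subset hI
    have hI1 := card_pos.2 hI0
    have hI2 := card_le_card hI
    have h1 := key (f := fun Y => vecQ (α p) *
      if Even Y.card then vecQ (α p) ^ (M.card - I.card) * chi _ (symmDiff M I) Y else 0) ?_ ?_ ?_
    · rw [fourier_congr (H := fun Y => vecQ (α p) ^ (M.card - I.card + 1) *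
        chi _ (symmDiff M I) Y * extendZero t g (flip Y ε.1))] at h1
      · have h3 := fourier_pow_mul_chi_mul (isUnit_vecQ (k := k) (hα0 p)) (by omega) h1
        have h4 : M.card - (M.card - I.card + 1) = Nat.pred I.card := by
          rw [Nat.pred_eq_sub_one]
          omega
        rwa [h4] at h3
      · intro Y hY
        split_ifs with hev
        · ring
        · rw [hg0 Y hY hev]
          ring
    · intro Y
      refine mul_mem (vecQ_mem_rRing _) ?_
      split_ifs
      · exact mul_mem (pow_mem (vecQ_mem_rRing _) _) (chi_mem _ _ _)
      · exact zero_mem _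
    · intro Y _ hev
      rw [if_neg hev, mul_zero]
    · refine FourierDvd.mul_even_part (vecQ_mem_rRing _) halfQ_mem (two_mul_halfQ h2)
        (fourierDvd_chi (symmDiff_subset Subset.rfl hI) ?_)
      rw [hc]
      exact pow_mem_powMod _
  rcases I.eq_empty_or_nonempty with rfl | hI0
  -- The coefficient at `∅` equals the one at `{max M}`, and both required exponents are `0`.
  · have hm : ∀ y ∈ M, y ≤ M.max' h0 := fun y hy => M.le_max' y hy
    rw [← fourier_symmDiff_max hm hg0]
    have h3 : symmDiff (∅ : Finset (Fin n)) {M.max' h0} = {M.max' h0} := bot_symmDiff _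
    rw [h3]
    simpa using main {M.max' h0} (singleton_subset_iff.2 (M.max'_mem h0)) (singleton_nonempty _)
  · exact main I hI hI0

-- Restricting to `Sub(t, w)` and extending by zero takes the even part on each class, at the cost
-- of one factor `α_p`.
include h2 hσ in
theorem YLower_le_XLower : YLower α σ t w ≤ XLower α σ t w := by
  rintro _ ⟨g, hg, rfl⟩
  rw [SetLike.mem_coe, mem_XAll] at hg
  rw [mem_XLower, inX_extendZero_iff]
  have hval : ∀ ε : SubTo t w,
      LinearMap.funLeft (rRing σ) (QRing k V) Subtype.val g ε ∈ rRing σ := fun ε => hg.1 ε.1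
  refine ⟨hval, fun ε p X hX => ?_⟩
  refine FourierDvd.sigmaAll_mem h2 (hα0 := hα0) pred_mono (extendZero_mem hval) ?_ hX
  refine ((hg.fourierDvd h2 hσ ε.1 p).even_part (vecQ_mem_rRing _) halfQ_mem
    (two_mul_halfQ h2)).congr fun Y hY => ?_
  rw [extendZero]
  have hw : target t (flip Y ε.1) = w ↔ Even Y.card := by
    rw [← even_card_of_target_flip hY, ε.2]
  by_cases hev : Even Y.card
  · rw [if_pos hev, dif_pos (hw.2 hev)]
    rfl
  · rw [if_neg hev, dif_neg (fun h => hev (hw.1 h))]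

include h2 hα hGKM hσ in
theorem XUpper_le_dualMod_XLower : XUpper α σ t w ≤ dualMod ρ α σ t w (XLower α σ t w) :=
  fun h hh g hg => by
    rw [pairing_comm]
    exact pairing_mem h2 hα hGKM hσ hg hh

include h2 hα hGKM hσ in
theorem dualMod_YLower : dualMod ρ α σ t w (YLower α σ t w) = XUpper α σ t w :=
  le_antisymm (dualMod_YLower_le h2 hα hGKM hσ)
    ((XUpper_le_dualMod_XLower h2 hα hGKM hσ).trans (dualMod_anti (YLower_le_XLower h2 hσ)))

include h2 hα hGKM hσ in
theorem dualMod_XLower : dualMod ρ α σ t w (XLower α σ t w) = XUpper α σ t w :=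
  le_antisymm ((dualMod_anti (YLower_le_XLower h2 hσ)).trans (dualMod_YLower_le h2 hα hGKM hσ))
    (XUpper_le_dualMod_XLower h2 hα hGKM hσ)

include h2 hα hGKM hσ in
theorem dualMod_XUpper : dualMod ρ α σ t w (XUpper α σ t w) = XLower α σ t w :=
  le_antisymm (dualMod_XUpper_le h2 hα hGKM hσ) fun _ hg _ hh => pairing_mem h2 hα hGKM hσ hg hh

end Duality

/-! ### Graded homomorphisms -/

section Hom

variable {k : Type*} [Field k] {V : Type*} [AddCommGroup V] [Module k V]
  {W : Type*} [Group W] {B : Type*} {C : CoxeterMatrix B} {cs : CoxeterSystem C W} {n : ℕ}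
  {ρ : Representation k W V} {α : Refl cs → V} {σ : Submonoid (SymmetricAlgebra k V)}
  {t : Fin n → Refl cs} {w : W}

/-- The alternating sums have coefficients `±1`, so they commute with taking components. -/
theorem InX.comp (hσ : ∀ s ∈ σ, ∃ i, s ∈ symGr k V i) {e : ℕ → ℕ}
    {g : (Fin n → Bool) → QRing k V} (hg : InX α σ t e g) (i : ℤ) :
    InX α σ t e fun ε => BottSamelson.comp i (g ε) := by
  refine ⟨fun ε => comp_mem_rRing hσ i (hg.1 ε), fun ε p X hX => ?_⟩
  have h : sigmaAll X ε (fun ε => BottSamelson.comp i (g ε)) =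
      BottSamelson.comp i (sigmaAll X ε g) := by
    rw [sigmaAll, sigmaAll, comp_sum]
    exact sum_congr rfl fun Y _ => (comp_neg_one_pow_mul _ _ _).symm
  rw [h]
  exact comp_mem_powMod hσ i (hg.2 ε p X hX)

theorem extendZero_comp (g : SubTo t w → QRing k V) (i : ℤ) :
    extendZero t (fun ε => comp i (g ε)) = fun ε => comp i (extendZero t g ε) := by
  funext ε
  unfold extendZero
  split_ifs
  · rfl
  · exact (comp_zero i).symm

theorem comp_mem_XUpper (hσ : ∀ s ∈ σ, ∃ i, s ∈ symGr k V i) {g : SubTo t w → QRing k V}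
    (hg : g ∈ XUpper α σ t w) (i : ℤ) : (fun ε => comp i (g ε)) ∈ XUpper α σ t w := by
  rw [mem_XUpper, extendZero_comp]
  exact (mem_XUpper.1 hg).comp hσ i

theorem comp_mem_XLower (hσ : ∀ s ∈ σ, ∃ i, s ∈ symGr k V i) {g : SubTo t w → QRing k V}
    (hg : g ∈ XLower α σ t w) (i : ℤ) : (fun ε => comp i (g ε)) ∈ XLower α σ t w := by
  rw [mem_XLower, extendZero_comp]
  exact (mem_XLower.1 hg).comp hσ i

theorem exists_sum_comp_fun {ι' : Type*} [Finite ι'] (g : ι' → QRing k V) :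
    ∃ S : Finset ℤ, g = ∑ i ∈ S, fun ε => comp i (g ε) := by
  classical
  have := Fintype.ofFinite ι'
  choose S hS using fun ε => exists_sum_comp (g ε)
  refine ⟨univ.biUnion S, funext fun ε => ?_⟩
  rw [Finset.sum_apply, hS ε _ (subset_biUnion_of_mem S (mem_univ ε))]

variable (ρ α t w) in
/-- The pairing as a map from a module to the dual of another one. -/
def pairHom {N P : Submodule (rRing σ) (SubTo t w → QRing k V)}
    (hP : P ≤ dualMod ρ α σ t w N) : P →ₗ[rRing σ] N →ₗ[rRing σ] rRing σ :=
  LinearMap.mk₂ (rRing σ)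
    (fun h m => ⟨pairing ρ α t w h.1 m.1, hP h.2 m.1 m.2⟩)
    (fun h h' m => Subtype.ext (by simp [pairing, add_mul, sum_add_distrib]))
    (fun r h m => Subtype.ext (by
      simp only [pairing, SetLike.val_smul, Pi.smul_apply, Subring.smul_def, smul_eq_mul,
        Subring.coe_mul, mul_sum, mul_assoc]))
    (fun h m m' => Subtype.ext (by simp [pairing, mul_add, add_mul, sum_add_distrib]))
    (fun r h m => Subtype.ext (by
      simp only [pairing, SetLike.val_smul, Pi.smul_apply, Subring.smul_def, smul_eq_mul,
        Subring.coe_mul, mul_sum]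
      exact sum_congr rfl fun ε _ => by ring))

/-! ### Degrees of pairings and representability of homomorphisms. -/

variable {N P : Submodule (rRing σ) (SubTo t w → QRing k V)}

theorem oFun_eq_algebraMap (ε : Fin n → Bool) : oFun ρ α t ε =
    algebraMap (SymmetricAlgebra k V) _ (∏ i, ι k V (ρ (before t ε i) (α (t i)))) := by
  rw [map_prod]
  rfl

theorem prod_ι_oFun_mem (ε : Fin n → Bool) :
    ∏ i, ι k V (ρ (before t ε i) (α (t i))) ∈ symGr k V (2 * n) := by
  have := prod_ι_mem_symGr (k := k) univ fun i => ρ (before t ε i) (α (t i))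
  rwa [card_univ, Fintype.card_fin] at this

theorem prod_ι_oFun_ne_zero (hα0 : ∀ p, α p ≠ 0) (ε : Fin n → Bool) :
    ∏ i, ι k V (ρ (before t ε i) (α (t i))) ≠ 0 := by
  intro h
  have := isUnit_oFun ρ α hα0 t ε
  rw [oFun_eq_algebraMap, h, map_zero] at this
  exact not_isUnit_zero this

theorem pairing_mem_qGr (hα0 : ∀ p, α p ≠ 0) {i j : ℤ} {g h : SubTo t w → QRing k V}
    (hg : ∀ ε, g ε ∈ qGr k V i) (hh : ∀ ε, h ε ∈ qGr k V j) :
    pairing ρ α t w g h ∈ qGr k V (i - 2 * n + j) := by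
  refine sum_mem fun ε _ => ?_
  have h1 : Ring.inverse (oFun ρ α t ε.1) ∈ qGr k V (-(2 * n)) := by
    rw [oFun_eq_algebraMap]
    exact inverse_mem_qGr (prod_ι_oFun_mem ε.1) (prod_ι_oFun_ne_zero hα0 ε.1)
  have h3 : i - 2 * n + j = i + j + -(2 * n) := by ring
  rw [h3]
  exact mul_mem_qGr (mul_mem_qGr (hg ε) (hh ε)) h1

open Classical in
theorem mem_qGr_of_pairing_single (hα0 : ∀ p, α p ≠ 0) {i b : ℤ}
    (hb : dSym α t (fun _ => True) ∈ symGr k V b)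
    {g : SubTo t w → QRing k V} {ε : SubTo t w}
    (h : pairing ρ α t w g (Pi.single ε (dQ α t fun _ => True)) ∈ qGr k V (i - 2 * n + b)) :
    g ε ∈ qGr k V i := by
  rw [pairing_single] at h
  have h1 := mul_mem_qGr h (algebraMap_mem_qGr (prod_ι_oFun_mem (ρ := ρ) (α := α) (t := t) ε.1))
  rw [← oFun_eq_algebraMap, mul_assoc, Ring.inverse_mul_cancel _ (isUnit_oFun ρ α hα0 t ε.1),
    mul_one, mul_comm (g ε), dQ] at h1
  have h3 := mem_qGr_of_algebraMap_mul hb (dSym_ne_zero hα0 _) h1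
  have h4 : i - 2 * n + b + 2 * n - b = i := by ring
  rwa [h4] at h3

open Classical in
theorem eq_zero_of_pairing_single (hα0 : ∀ p, α p ≠ 0) {g : SubTo t w → QRing k V} {ε : SubTo t w}
    (h : pairing ρ α t w g (Pi.single ε (dQ α t fun _ => True)) = 0) : g ε = 0 := by
  obtain ⟨b, hb⟩ := exists_dSym_mem (k := k) (α := α) (t := t) fun _ => True
  have hd : IsUnit (dQ α t (fun _ => True) : QRing k V) := isUnit_algebraMap hb (dSym_ne_zero hα0 _)
  have hi : IsUnit (Ring.inverse (oFun ρ α t ε.1)) := (isUnit_oFun ρ α hα0 t ε.1).ringInverse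
  rwa [pairing_single, hi.mul_left_eq_zero, hd.mul_left_eq_zero] at h

open Classical in
/-- All homomorphisms from a sufficiently large module to `R` are given by the pairing. -/
theorem pairHom_surjective (hα0 : ∀ p, α p ≠ 0) (hNval : ∀ m ∈ N, ∀ ε, m ε ∈ rRing σ)
    (hN : ∀ ε : SubTo t w, (Pi.single ε (dQ α t fun _ => True) : SubTo t w → QRing k V) ∈ N)
    (hP : P = dualMod ρ α σ t w N) : Function.Surjective (pairHom ρ α t w hP.le) := by
  intro φ
  obtain ⟨b, hb⟩ := exists_dSym_mem (k := k) (α := α) (t := t) fun _ => True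
  have hd : IsUnit (dQ α t (fun _ => True) : QRing k V) := isUnit_algebraMap hb (dSym_ne_zero hα0 _)
  let s : SubTo t w → N := fun ε => ⟨Pi.single ε (dQ α t fun _ => True), hN ε⟩
  -- These values are forced by the equation `⟨h | s ε⟩ = φ (s ε)`.
  let h : SubTo t w → QRing k V := fun ε =>
    oFun ρ α t ε.1 * Ring.inverse (dQ α t fun _ => True) * (φ (s ε) : QRing k V)
  have key : ∀ m : N, pairing ρ α t w h m.1 = φ m := by
    intro m
    let d : rRing σ := ⟨dQ α t fun _ => True, dQ_mem _⟩
    -- The values of `m` lie in `R`, so `d • m` is an `R`-combination of the `s ε` and `φ` is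
    -- determined by them.
    have h1 : d • m = ∑ ε, (⟨m.1 ε, hNval m.1 m.2 ε⟩ : rRing σ) • s ε := by
      refine Subtype.ext (funext fun ε => ?_)
      rw [AddSubmonoidClass.coe_finsetSum, Finset.sum_apply, sum_eq_single ε]
      · simp only [SetLike.val_smul, Pi.smul_apply, Subring.smul_def, smul_eq_mul, s,
          Pi.single_eq_same, d]
        ring
      · intro ε' _ hne
        simp only [SetLike.val_smul, Pi.smul_apply, Subring.smul_def, smul_eq_mul, s]
        rw [Pi.single_eq_of_ne hne.symm, mul_zero]
      · exact fun h => (h (mem_univ _)).elim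
    have h3 := congrArg (fun x => (φ x : QRing k V)) h1
    simp only [map_smul, map_sum, smul_eq_mul, Subring.coe_mul,
      AddSubmonoidClass.coe_finsetSum] at h3
    refine hd.mul_left_cancel (Eq.trans ?_ h3.symm)
    rw [pairing, mul_sum]
    refine sum_congr (by congr!) fun ε _ => ?_
    have h4 := Ring.mul_inverse_cancel _ hd
    have h5 := Ring.mul_inverse_cancel _ (isUnit_oFun ρ α hα0 t ε.1)
    simp only [h]
    linear_combination m.1 ε * (φ (s ε) : QRing k V) *
      (oFun ρ α t ε.1 * Ring.inverse (oFun ρ α t ε.1) * h4 + h5)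
  have hh : h ∈ P := by
    rw [hP]
    intro m hm
    rw [key ⟨m, hm⟩]
    exact (φ ⟨m, hm⟩).2
  exact ⟨⟨h, hh⟩, LinearMap.ext fun m => Subtype.ext (key m)⟩

open Classical in
/-- The dual of a sufficiently large graded module is its graded dual. -/
theorem exists_equiv_homGr (hα0 : ∀ p, α p ≠ 0) (hNval : ∀ m ∈ N, ∀ ε, m ε ∈ rRing σ)
    (hN : ∀ ε : SubTo t w, (Pi.single ε (dQ α t fun _ => True) : SubTo t w → QRing k V) ∈ N)
    (hP : dualMod ρ α σ t w N = P) (hcomp : ∀ h ∈ P, ∀ i, (fun ε => comp i (h ε)) ∈ P) :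
    ∃ e : P ≃ₗ[rRing σ] homGr N,
      (∀ (h : P) (m : N), ((e h).1 m : QRing k V) = pairing ρ α t w h.1 m.1) ∧
        ∀ (i : ℤ) (h : P), h.1 ∈ modGr P i ↔ (e h).1 ∈ homDeg N (i - 2 * n) := by
  have hdeg : ∀ (i : ℤ) (h : P), (∀ ε, h.1 ε ∈ qGr k V i) →
      pairHom ρ α t w hP.ge h ∈ homDeg N (i - 2 * n) := fun i h hh j m hm =>
    pairing_mem_qGr hα0 hh hm.2
  -- The finitely many components of `h` lie in `P` and give homogeneous homomorphisms.
  have hmem : ∀ h : P, pairHom ρ α t w hP.ge h ∈ homGr N := by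
    intro h
    obtain ⟨S, hS⟩ := exists_sum_comp_fun h.1
    have h1 : h = ∑ i ∈ S, (⟨_, hcomp h.1 h.2 i⟩ : P) := Subtype.ext (by
      rw [AddSubmonoidClass.coe_finsetSum]
      exact hS)
    rw [h1, map_sum]
    exact sum_mem fun i _ => Submodule.subset_span (Set.mem_iUnion.2
      ⟨i - 2 * n, hdeg i _ fun ε => comp_mem_qGr i _⟩)
  have hinj : Function.Injective (pairHom ρ α t w hP.ge) := by
    rw [injective_iff_map_eq_zero]
    intro h hh
    refine Subtype.ext (funext fun ε => eq_zero_of_pairing_single (ρ := ρ) hα0 ?_)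
    have h1 := congrArg Subtype.val (LinearMap.congr_fun hh ⟨_, hN ε⟩)
    exact h1
  refine ⟨LinearEquiv.ofBijective ((pairHom ρ α t w hP.ge).codRestrict (homGr N) hmem)
    ⟨fun h h' hh => hinj (congrArg Subtype.val hh), fun φ => ?_⟩, fun h m => rfl, fun i h => ?_⟩
  · obtain ⟨h, hh⟩ := pairHom_surjective hα0 hNval hN hP.symm φ.1
    exact ⟨h, Subtype.ext hh⟩
  · constructor
    · exact fun hh => hdeg i h hh.2
    · intro hh
      refine ⟨h.2, fun ε => ?_⟩
      obtain ⟨b, hb⟩ := exists_dSym_mem (k := k) (α := α) (t := t) fun _ => True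
      -- A homogeneous multiple of the delta function at `ε`, of degree `b`, detects the degree of
      -- `h ε`.
      refine mem_qGr_of_pairing_single (ρ := ρ) hα0 hb (hh b ⟨_, hN ε⟩ ⟨hN ε, fun ε' => ?_⟩)
      change (Pi.single ε (dQ α t fun _ => True) : SubTo t w → QRing k V) ε' ∈ _
      rw [Pi.single_apply]
      split_ifs
      · exact algebraMap_mem_qGr hb
      · exact zero_mem _

end Hom

end BottSamelson

end

theorem mainTheorem7 {k : Type*} [Field k] (h2 : (2 : k) ≠ 0)
    {V : Type*} [AddCommGroup V] [Module k V] [FiniteDimensional k V]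
    {W : Type*} [Group W] {B : Type*} {C : CoxeterMatrix B} (cs : CoxeterSystem C W)
    (ρ : Representation k W V) (hρ : Function.Injective ρ)
    (hS : ∀ b : B, ∃ a : V, BottSamelson.IsRoot ρ (cs.simple b) a)
    (α : BottSamelson.Refl cs → V)
    (hα : ∀ p : BottSamelson.Refl cs, BottSamelson.IsRoot ρ p.1 (α p))
    (hGKM : ∀ p q : BottSamelson.Refl cs, (∃ c : k, c ≠ 0 ∧ α p = c • α q) → p = q)
    (σ : Submonoid (SymmetricAlgebra k V)) (hσ : BottSamelson.Admissible ρ α σ)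
    {n : ℕ} (t : Fin n → BottSamelson.Refl cs) (w : W) :
    (BottSamelson.dualMod ρ α σ t w (BottSamelson.YLower α σ t w) =
        BottSamelson.dualMod ρ α σ t w (BottSamelson.XLower α σ t w) ∧
      BottSamelson.dualMod ρ α σ t w (BottSamelson.XLower α σ t w) =
        BottSamelson.XUpper α σ t w) ∧
    (∀ N : Submodule (BottSamelson.rRing σ) (BottSamelson.SubTo t w → BottSamelson.QRing k V),
      BottSamelson.IsGradedSubmodule N →
      BottSamelson.YLower α σ t w ≤ N → N ≤ BottSamelson.XLower α σ t w →
      ∃ e : BottSamelson.XUpper α σ t w ≃ₗ[BottSamelson.rRing σ] BottSamelson.homGr N,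
        (∀ (h : BottSamelson.XUpper α σ t w) (m : N),
          ((e h).1 m : BottSamelson.QRing k V) = BottSamelson.pairing ρ α t w m.1 h.1) ∧
        ∀ (i : ℤ) (h : BottSamelson.XUpper α σ t w),
          h.1 ∈ BottSamelson.modGr (BottSamelson.XUpper α σ t w) i ↔
            (e h).1 ∈ BottSamelson.homDeg N (i - 2 * n)) ∧
    ∃ e : BottSamelson.XLower α σ t w ≃ₗ[BottSamelson.rRing σ]
        BottSamelson.homGr (BottSamelson.XUpper α σ t w),
      (∀ (g : BottSamelson.XLower α σ t w) (h : BottSamelson.XUpper α σ t w),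
        ((e g).1 h : BottSamelson.QRing k V) = BottSamelson.pairing ρ α t w g.1 h.1) ∧
      ∀ (i : ℤ) (g : BottSamelson.XLower α σ t w),
        g.1 ∈ BottSamelson.modGr (BottSamelson.XLower α σ t w) i ↔
          (e g).1 ∈ BottSamelson.homDeg (BottSamelson.XUpper α σ t w) (i - 2 * n) := by
  have hα0 : ∀ p, α p ≠ 0 := fun p => (hα p).ne_zero h2
  have hle : ∀ p, σ ≤ BottSamelson.notDvd (α p) (hα0 p) := fun p s hs => hσ.not_dvd p s hs
  have hY := BottSamelson.dualMod_YLower (t := t) (w := w) h2 hα hGKM hle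
  have hX := BottSamelson.dualMod_XLower (t := t) (w := w) h2 hα hGKM hle
  refine ⟨⟨hY.trans hX.symm, hX⟩, fun N _ hYN hNX => ?_, ?_⟩
  -- Taking duals reverses inclusions, and the two extremes `Y_w` and `X_w` have the same dual.
  · have hN : BottSamelson.dualMod ρ α σ t w N = BottSamelson.XUpper α σ t w :=
      le_antisymm ((BottSamelson.dualMod_anti hYN).trans hY.le)
        (hX.ge.trans (BottSamelson.dualMod_anti hNX))
    obtain ⟨e, he, hdeg⟩ := BottSamelson.exists_equiv_homGr hα0 (fun m hm => (hNX hm).1)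
      (fun ε => hYN (BottSamelson.XUpper_le_YLower (BottSamelson.single_mem_XUpper ε))) hN
      fun h hh => BottSamelson.comp_mem_XUpper hσ.graded hh
    exact ⟨e, fun h m => (he h m).trans (BottSamelson.pairing_comm _ _), hdeg⟩
  · exact BottSamelson.exists_equiv_homGr hα0 (fun m hm => hm.1)
      BottSamelson.single_mem_XUpper (BottSamelson.dualMod_XUpper h2 hα hGKM hle)
      fun h hh => BottSamelson.comp_mem_XLower hσ.graded hh
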